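/- Let $V$ be a finite set (the variables) and, for $i\in V$, let $A_i$ be a finite alphabet with at least two elements. Let $X_k=(X_k^{(i)})_{i\in V}$, $k=1,2,\dots$, be independent random vectors with common law $P$ on $\prod_{i\in V}A_i$, and let $M_k\in\{0,1\}^V$ be random, where $M_k^{(i)}=1$ means that the entry $X_k^{(i)}$ is observed and $M_k^{(i)}=0$ that it is missing; the process $(M_k)_k$ is independent of the process $(X_k)_k$ and otherwise arbitrary. Let $[i,j]_n$ be the set of $k\le n$ with $M_k^{(i)}=M_k^{(j)}=1$, and $n(i,j)$ its cardinality. For a finite alphabet $A$, hyperparameters $a(x)>0$ and a sequence over $A$ in which $x$ occurs $c(x)$ times, the Bayes measure is $$\frac{\Gamma(\sum_x a(x))}{\Gamma(\sum_x (c(x)+a(x)))}\prod_{x\in A}\frac{\Gamma(c(x)+a(x))}{\Gamma(a(x))}.$$ Fix positive hyperparameters on each $A_i$ and on each $A_i\times A_j$, the latter depending only on the unordered pair $\{i,j\}$. Let $Q^n_j(i)$, $Q^n_i(j)$, $Q^n(i,j)$ be the Bayes measures of $(X_k^{(i)})_{k\in[i,j]_n}$, $(X_k^{(j)})_{k\in[i,j]_n}$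 and $(X_k^{(i)},X_k^{(j)})_{k\in[i,j]_n}$, and $$K^n(i,j)=\frac1{n(i,j)}\log\frac{Q^n(i,j)}{Q^n_j(i)\,Q^n_i(j)} .$$ Assume that every value in $A_i$ has positive probability under $P$ for every $i\in V$, or that all hyperparameters equal $1/2$. The Chow–Liu algorithm with symmetric weights $w(i,j)$ starts with $E=\emptyset$ and $E'$ the set of all pairs $\{i,j\}$, $i\ne j$; until $E'$ is empty, it takes a pair of largest weight in $E'$ (ties broken arbitrarily), adds it to $E$ if its weight is positive and this creates no loop, and removes it from $E'$; it returns $E$. Say that $P$ factors along a forest $E$ on $V$ if $$P(x)=\prod_{i\in V}P(x_i)\prod_{\{i,j\}\in E}\frac{P(x_i,x_j)}{P(x_i)P(x_j)}\quad\text{for all }x,$$ and call $E$ a true forest of $P$ if, in addition, $P$ factors along no forest properly contained in $E$. Suppose that, for all $i\neq j$, $n(i,j)\to\infty$ as $n\to\infty$ with probability one. Then, with probability one, for all sufficiently large $n$ the Chow–Liu algorithm with the weights $K^n(i,j)$ has an output, and every output $E$ satisfies the following. 1. $E$ is also an output of the Chow–Liu algorithm with the true mutual informations $I(i,j)$ of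 $(X^{(i)},X^{(j)})$ as weights. 2. If $P$ factors along some forest, then $E$ is a true forest of $P$. 3. If $P$ has exactly one true forest $T$, then $E=T$. -/

import Mathlib

open MeasureTheory ProbabilityTheory Filter

namespace ForestLearning

noncomputable section

/-- Bayes measure of a sequence over the finite alphabet `A` in which each `x` occurs `c x` times,
for the Dirichlet prior with hyperparameters `a`. -/
def bayesMeasure {A : Type*} [Fintype A] (a : A → ℝ) (c : A → ℕ) : ℝ :=
  Real.Gamma (∑ x, a x) / Real.Gamma (∑ x, ((c x : ℝ) + a x)) *
    ∏ x, Real.Gamma ((c x : ℝ) + a x) / Real.Gamma (a x)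

section Data

variable {V : Type*} {A : V → Type*} [∀ i, Fintype (A i)] [∀ i, DecidableEq (A i)]

/-- The rows among the first `n` in which both entries `i` and `j` are observed;
`m k i = true` means that the entry `i` of row `k` is not missing. -/
def jointRows (m : ℕ → V → Bool) (n : ℕ) (i j : V) : Finset ℕ :=
  (Finset.range n).filter fun k => m k i = true ∧ m k j = true

/-- Bayes measure of the `i`-th entries of the rows in which `i` and `j` are both observed. -/
def bayesSingle (a : ∀ i, A i → ℝ) (x : ℕ → ∀ i, A i) (m : ℕ → V → Bool) (n : ℕ) (i j : V) : ℝ :=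
  bayesMeasure (a i) fun u => ((jointRows m n i j).filter fun k => x k i = u).card

/-- Bayes measure of the pairs of `i`-th and `j`-th entries of the rows in which both are
observed. -/
def bayesPair (b : ∀ i j, A i → A j → ℝ) (x : ℕ → ∀ i, A i) (m : ℕ → V → Bool) (n : ℕ)
    (i j : V) : ℝ :=
  bayesMeasure (fun u : A i × A j => b i j u.1 u.2) fun u =>
    ((jointRows m n i j).filter fun k => x k i = u.1 ∧ x k j = u.2).card

/-- The weight `K^n(i,j)`. -/
def weightK (a : ∀ i, A i → ℝ) (b : ∀ i j, A i → A j → ℝ) (x : ℕ → ∀ i, A i)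
    (m : ℕ → V → Bool) (n : ℕ) (i j : V) : ℝ :=
  1 / ((jointRows m n i j).card : ℝ) *
    Real.log (bayesPair b x m n i j / (bayesSingle a x m n i j * bayesSingle a x m n j i))

end Data

section Algorithm

variable {V : Type*} [Fintype V] [DecidableEq V]

/-- `ChowLiuState w E E'`: the algorithm with the symmetric weights `w` can reach the state in
which the edges in `E` have been added and the pairs in `E'` are still to be examined. In each
step a pair of largest weight in `E'` is removed from `E'`, and it is added to `E` if and only if
its weight is positive and no loop is created. Ties may be broken in any way. -/
inductive ChowLiuState (w : V → V → ℝ) : Finset (Sym2 V) → Finset (Sym2 V) → Prop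
  | init : ChowLiuState w ∅ (Finset.univ.filter fun e => ¬ e.IsDiag)
  | add {E E' : Finset (Sym2 V)} {i j : V} (h : ChowLiuState w E E') (hij : s(i, j) ∈ E')
      (hmax : ∀ k l, s(k, l) ∈ E' → w k l ≤ w i j)
      (hadd : 0 < w i j ∧ (SimpleGraph.fromEdgeSet (↑(insert s(i, j) E) : Set (Sym2 V))).IsAcyclic) :
      ChowLiuState w (insert s(i, j) E) (E'.erase s(i, j))
  | skip {E E' : Finset (Sym2 V)} {i j : V} (h : ChowLiuState w E E') (hij : s(i, j) ∈ E')
      (hmax : ∀ k l, s(k, l) ∈ E' → w k l ≤ w i j)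
      (hskip : ¬ (0 < w i j ∧
        (SimpleGraph.fromEdgeSet (↑(insert s(i, j) E) : Set (Sym2 V))).IsAcyclic)) :
      ChowLiuState w E (E'.erase s(i, j))

/-- `E` is an edge set that the algorithm with weights `w` can return. -/
def IsChowLiuOutput (w : V → V → ℝ) (E : Finset (Sym2 V)) : Prop :=
  ChowLiuState w E ∅

end Algorithm

section Model

variable {V : Type*} {A : V → Type*} [∀ i, MeasurableSpace (A i)]

/-- `P(X^(i) = u)`. -/
def marginal (P : Measure (∀ i, A i)) (i : V) (u : A i) : ℝ :=
  P.real {y | y i = u}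

/-- `P(X^(i) = u, X^(j) = v)`. -/
def pairMarginal (P : Measure (∀ i, A i)) (i j : V) (u : A i) (v : A j) : ℝ :=
  P.real {y | y i = u ∧ y j = v}

/-- The mutual information `I(i,j)`; terms with probability zero vanish. -/
def mutualInfo [∀ i, Fintype (A i)] (P : Measure (∀ i, A i)) (i j : V) : ℝ :=
  ∑ u : A i, ∑ v : A j, pairMarginal P i j u v *
    Real.log (pairMarginal P i j u v / (marginal P i u * marginal P j v))

/-- The factor `P(x_i, x_j) / (P(x_i) P(x_j))` of the unordered pair `{i, j}`. -/
def edgeFactor (P : Measure (∀ i, A i)) (x : ∀ i, A i) : Sym2 V → ℝ :=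
  Sym2.lift ⟨fun i j => pairMarginal P i j (x i) (x j) / (marginal P i (x i) * marginal P j (x j)),
    fun i j => by simp only [pairMarginal, and_comm, mul_comm]⟩

/-- `E` is a forest on `V`, and `P` is the distribution
`∏_{i ∈ V} P(x_i) ∏_{{i,j} ∈ E} P(x_i, x_j) / (P(x_i) P(x_j))`. -/
def FactorsAlongForest [Fintype V] (P : Measure (∀ i, A i)) (E : Finset (Sym2 V)) : Prop :=
  (∀ e ∈ E, ¬ e.IsDiag) ∧
  (SimpleGraph.fromEdgeSet (↑E : Set (Sym2 V))).IsAcyclic ∧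
  ∀ x : ∀ i, A i, P.real {x} = (∏ i, marginal P i (x i)) * ∏ e ∈ E, edgeFactor P x e

/-- A true forest of `P`: a forest along which `P` factors, without superfluous edges. -/
def IsTrueForest [Fintype V] (P : Measure (∀ i, A i)) (E : Finset (Sym2 V)) : Prop :=
  Minimal (FactorsAlongForest P) E

end Model

end

end ForestLearning

/-! The algorithm sees its weights only through their signs and their order. It therefore suffices
that, almost surely and for all large `n`, strict inequalities between mutual informations persist
for the weights `K^n` and that `K^n(i,j)` is positive exactly when `I(i,j)` is; ties may then be
split in any way (`ChowLiuState.of_lt_imp_lt`). Both follow from `ae_tendsto_weightK`: `K^n → I`,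
and `K^n ≤ 0` eventually if `I = 0`.

Convergence alone does not decide the sign when `I = 0`. With `N = n(i,j)`, Stirling's formula
writes the log Bayes factor as `N` times the empirical mutual information plus a logarithmic
penalty, up to `O(1)`. Under independence the first term is at most a chi-square statistic, and the
penalty is `-(|A_i|-1)(|A_j|-1)/2 * log N + O(1)`. So the counts need only deviate from their means
by `o(√(N log N))` almost surely. This weak iterated-logarithm bound comes from a maximal Hoeffding
inequality on dyadic blocks and Borel–Cantelli. The missing entries are handled by Fubini: for a
fixed mask, the jointly observed rows form a subsequence of an i.i.d. sequence.

For the true forests, the cross-entropy of `P` against a forest density depends on the forest only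
through its total mutual information (`sum_mul_log_forestDensity`), and a greedy output has maximal
weight (`IsChowLiuOutput.sum_le`). If `P` factors along some forest, the output thus reaches
equality in Gibbs' inequality, so `P` factors along it as well. It is minimal because all its edges
have positive weight. -/

namespace ForestLearning

/-! ### Exchange and leaves in forests. -/

section Graph

variable {V : Type*}

/-- The forest exchange property: an edge that closes a loop in the forest `T`, but not in the
subforest `E`, can replace an edge of `T` outside `E`. -/
lemma exists_exchange [DecidableEq V] {E T : Finset (Sym2 V)} {i j : V} (hij : i ≠ j)
    (hT : (SimpleGraph.fromEdgeSet (T : Set (Sym2 V))).IsAcyclic)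
    (hE : (SimpleGraph.fromEdgeSet (↑(insert s(i, j) E) : Set (Sym2 V))).IsAcyclic)
    (heE : s(i, j) ∉ E)
    (hTe : ¬ (SimpleGraph.fromEdgeSet (↑(insert s(i, j) T) : Set (Sym2 V))).IsAcyclic) :
    ∃ f ∈ T, f ∉ E ∧
      (SimpleGraph.fromEdgeSet (↑(insert s(i, j) (T.erase f)) : Set (Sym2 V))).IsAcyclic := by
  have key : ∀ S : Finset (Sym2 V),
      SimpleGraph.fromEdgeSet (↑(insert s(i, j) S) : Set (Sym2 V)) =
        SimpleGraph.fromEdgeSet (S : Set (Sym2 V)) ⊔ SimpleGraph.edge i j := by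
    intro S
    rw [SimpleGraph.edge, ← SimpleGraph.fromEdgeSet_union, Finset.coe_insert, Set.insert_eq,
      Set.union_comm]
  rw [key] at hE hTe
  rw [SimpleGraph.isAcyclic_sup_fromEdgeSet_iff] at hE hTe
  have hreach : (SimpleGraph.fromEdgeSet (T : Set (Sym2 V))).Reachable i j := by
    by_contra h
    exact hTe ⟨hT, fun h' => (h h').elim⟩
  have hnot : ¬ (SimpleGraph.fromEdgeSet (E : Set (Sym2 V))).Reachable i j := by
    intro h
    rcases hE.2 h with h | h
    · exact hij h
    · simp [heE] at h
  obtain ⟨p, hp⟩ := hreach.exists_isPath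
  -- The path `p` of `T` cannot lie inside `E`, which does not connect `i` and `j`.
  have hex : ∃ f ∈ p.edges, f ∉ E := by
    by_contra! hcon
    refine hnot ⟨p.transfer _ fun e he => ?_⟩
    have h1 := p.edges_subset_edgeSet he
    rw [SimpleGraph.edgeSet_fromEdgeSet] at h1 ⊢
    exact ⟨hcon e he, h1.2⟩
  obtain ⟨f, hfp, hfE⟩ := hex
  have hfT : f ∈ T := by
    have h1 := p.edges_subset_edgeSet hfp
    rw [SimpleGraph.edgeSet_fromEdgeSet] at h1
    exact h1.1
  have hle : SimpleGraph.fromEdgeSet (↑(T.erase f) : Set (Sym2 V)) ≤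
      SimpleGraph.fromEdgeSet (T : Set (Sym2 V)) :=
    SimpleGraph.fromEdgeSet_mono (by exact_mod_cast Finset.erase_subset f T)
  refine ⟨f, hfT, hfE, ?_⟩
  rw [key]
  -- A path from `i` to `j` avoiding `f` would be a second path in the forest `T`, whereas `p` uses
  -- `f`.
  refine (hT.anti hle).sup_edge_of_not_reachable fun h => ?_
  obtain ⟨q, hq⟩ := h.exists_isPath
  have hpq : p = q.mapLe hle :=
    Subtype.mk.inj ((hT.subsingleton_path i j).elim ⟨p, hp⟩ ⟨q.mapLe hle, hq.mapLe hle⟩)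
  have hfq : f ∈ q.edges := by
    rw [hpq] at hfp
    simpa using hfp
  have h1 := q.edges_subset_edgeSet hfq
  rw [SimpleGraph.edgeSet_fromEdgeSet] at h1
  simp at h1

/-- A finite forest with at least one edge has a leaf. -/
lemma exists_leaf [Fintype V] {G : SimpleGraph V} (hG : G.IsAcyclic) {u v : V} (huv : G.Adj u v) :
    ∃ x y, G.Adj x y ∧ ∀ z, G.Adj x z → z = y := by
  -- A path is prolonged at its start until every neighbour of the start lies on it. Acyclicity then
  -- leaves only the second vertex as a neighbour.
  suffices h : ∀ n (u v : V) (p : G.Walk u v), p.IsPath → 0 < p.length →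
      Fintype.card V - p.length = n → ∃ x y, G.Adj x y ∧ ∀ z, G.Adj x z → z = y from
    h _ u v huv.toWalk (SimpleGraph.Walk.IsPath.of_adj huv) (by simp) rfl
  intro n
  induction n with
  | zero =>
    intro u v p hp _ h
    have := hp.length_lt
    omega
  | succ n ih =>
    intro u v p hp hpos h
    by_cases hz : ∃ z, G.Adj u z ∧ z ∉ p.support
    · obtain ⟨z, hz, hzp⟩ := hz
      refine ih z v (SimpleGraph.Walk.cons hz.symm p) (hp.cons hzp) (by simp) ?_
      rw [SimpleGraph.Walk.length_cons]
      omega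
    · push Not at hz
      refine ⟨u, p.snd, p.adj_snd ?_, fun z hz' => hG.eq_snd_of_adj_start hp hz' (hz z hz')⟩
      intro hnil
      have := SimpleGraph.Walk.length_eq_zero_iff.mpr hnil
      omega

end Graph

/-! ### The greedy algorithm: termination, dependence on the order of the weights, optimality. -/

section Algorithm

variable {V : Type*} [Fintype V] [DecidableEq V] {w w' : V → V → ℝ} {E E' : Finset (Sym2 V)}

lemma ChowLiuState.not_isDiag_of_mem_remaining (h : ChowLiuState w E E') :
    ∀ e ∈ E', ¬ e.IsDiag := by
  induction h with
  | init => simp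
  | add _ _ _ _ ih => exact fun e he => ih e (Finset.mem_of_mem_erase he)
  | skip _ _ _ _ ih => exact fun e he => ih e (Finset.mem_of_mem_erase he)

lemma ChowLiuState.not_isDiag (h : ChowLiuState w E E') : ∀ e ∈ E, ¬ e.IsDiag := by
  induction h with
  | init => simp
  | add h hij _ _ ih =>
    intro e he
    rcases Finset.mem_insert.mp he with rfl | he
    · exact h.not_isDiag_of_mem_remaining _ hij
    · exact ih e he
  | skip _ _ _ _ ih => exact ih

lemma ChowLiuState.isAcyclic (h : ChowLiuState w E E') :
    (SimpleGraph.fromEdgeSet (E : Set (Sym2 V))).IsAcyclic := by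
  induction h with
  | init => simp
  | add _ _ _ hadd _ => exact hadd.2
  | skip _ _ _ _ ih => exact ih

lemma ChowLiuState.disjoint (h : ChowLiuState w E E') : Disjoint E E' := by
  induction h with
  | init => simp
  | add _ _ _ _ ih =>
    rw [Finset.disjoint_left] at ih ⊢
    intro e he he'
    rcases Finset.mem_insert.mp he with rfl | he
    · simp at he'
    · exact ih he (Finset.mem_of_mem_erase he')
  | skip _ _ _ _ ih => exact ih.mono_right (Finset.erase_subset _ _)

lemma ChowLiuState.weight_pos {W : Sym2 V → ℝ} (hW : ∀ i j, W s(i, j) = w i j)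
    (h : ChowLiuState w E E') : ∀ e ∈ E, 0 < W e := by
  induction h with
  | init => simp
  | add _ _ _ hadd ih =>
    intro e he
    rcases Finset.mem_insert.mp he with rfl | he
    · rw [hW]; exact hadd.1
    · exact ih e he
  | skip _ _ _ _ ih => exact ih

/-- The algorithm always terminates with an output. -/
lemma exists_isChowLiuOutput (w : V → V → ℝ) : ∃ E, IsChowLiuOutput w E := by
  suffices h : ∀ n E E', E'.card = n → ChowLiuState w E E' → ∃ F, IsChowLiuOutput w F from
    h _ _ _ rfl ChowLiuState.init
  intro n
  induction n with
  | zero =>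
    intro E E' hc h
    rw [Finset.card_eq_zero] at hc
    subst hc
    exact ⟨E, h⟩
  | succ n ih =>
    intro E E' hc h
    have hne : (Finset.univ.filter fun p : V × V => s(p.1, p.2) ∈ E').Nonempty := by
      obtain ⟨e, he⟩ := Finset.card_pos.mp (by omega : 0 < E'.card)
      induction e with
      | h i j => exact ⟨(i, j), by simpa using he⟩
    obtain ⟨⟨i, j⟩, hmem, hmax⟩ := Finset.exists_max_image _ (fun p => w p.1 p.2) hne
    have hij : s(i, j) ∈ E' := by simpa using hmem
    have hmax' : ∀ k l, s(k, l) ∈ E' → w k l ≤ w i j :=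
      fun k l hkl => hmax (k, l) (by simpa using hkl)
    have hcard : (E'.erase s(i, j)).card = n := by
      rw [Finset.card_erase_of_mem hij]; omega
    by_cases hadd : 0 < w i j ∧
        (SimpleGraph.fromEdgeSet (↑(insert s(i, j) E) : Set (Sym2 V))).IsAcyclic
    · exact ih _ _ hcard (h.add hij hmax' hadd)
    · exact ih _ _ hcard (h.skip hij hmax' hadd)

/-- A run of the algorithm is also a run for any weights with the same signs whose strict
comparisons persist. -/
lemma ChowLiuState.of_lt_imp_lt
    (hlt : ∀ i j k l, i ≠ j → k ≠ l → w' i j < w' k l → w i j < w k l)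
    (hpos : ∀ i j, i ≠ j → (0 < w i j ↔ 0 < w' i j)) (h : ChowLiuState w E E') :
    ChowLiuState w' E E' := by
  have ne : ∀ {E E' : Finset (Sym2 V)}, ChowLiuState w E E' → ∀ {i j : V}, s(i, j) ∈ E' → i ≠ j :=
    fun h i j hij => by simpa using h.not_isDiag_of_mem_remaining _ hij
  have max : ∀ {E E' : Finset (Sym2 V)}, ChowLiuState w E E' → ∀ {i j : V}, s(i, j) ∈ E' →
      (∀ k l, s(k, l) ∈ E' → w k l ≤ w i j) → ∀ k l, s(k, l) ∈ E' → w' k l ≤ w' i j := by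
    intro E E' h i j hij hmax k l hkl
    by_contra! hcon
    exact (hmax k l hkl).not_gt (hlt i j k l (ne h hij) (ne h hkl) hcon)
  induction h with
  | init => exact .init
  | add h hij hmax hadd ih =>
    exact ih.add hij (max h hij hmax) ⟨(hpos _ _ (ne h hij)).mp hadd.1, hadd.2⟩
  | skip h hij hmax hskip ih =>
    exact ih.skip hij (max h hij hmax) fun hc => hskip ⟨(hpos _ _ (ne h hij)).mpr hc.1, hc.2⟩

/-- At every stage of the algorithm, the edges added so far extend by remaining pairs to a forest
that is at least as heavy as a given one. -/
lemma ChowLiuState.exists_heavier {W : Sym2 V → ℝ} (hW : ∀ i j, W s(i, j) = w i j)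
    {T : Finset (Sym2 V)} (hdiag : ∀ e ∈ T, ¬ e.IsDiag)
    (hT : (SimpleGraph.fromEdgeSet (T : Set (Sym2 V))).IsAcyclic) (h : ChowLiuState w E E') :
    ∃ S : Finset (Sym2 V), E ⊆ S ∧ S ⊆ E ∪ E' ∧
      (SimpleGraph.fromEdgeSet (S : Set (Sym2 V))).IsAcyclic ∧ ∑ e ∈ T, W e ≤ ∑ e ∈ S, W e := by
  induction h with
  | init => exact ⟨T, by simp, fun e he => by simpa using hdiag e he, hT, le_rfl⟩
  | @add E E' i j h hij hmax hadd ih =>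
    obtain ⟨S, hES, hSE, hS, hle⟩ := ih
    have hne : i ≠ j := by simpa using h.not_isDiag_of_mem_remaining _ hij
    have heE : s(i, j) ∉ E := Finset.disjoint_right.mp h.disjoint hij
    by_cases he : s(i, j) ∈ S
    · exact ⟨S, Finset.insert_subset he hES, by grind, hS, hle⟩
    by_cases hins : (SimpleGraph.fromEdgeSet (↑(insert s(i, j) S) : Set (Sym2 V))).IsAcyclic
    · refine ⟨insert s(i, j) S, by grind, by grind, hins, ?_⟩
      rw [Finset.sum_insert he, hW]
      linarith [hadd.1]
    · obtain ⟨f, hfS, hfE, hf⟩ := exists_exchange hne hS hadd.2 heE hins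
      refine ⟨insert s(i, j) (S.erase f), by grind, by grind, hf, ?_⟩
      have hfE' : f ∈ E' := by grind
      have hfw : W f ≤ W s(i, j) := by
        rw [hW]
        induction f with
        | h k l => rw [hW]; exact hmax k l hfE'
      rw [Finset.sum_insert (by grind)]
      have := Finset.add_sum_erase S W hfS
      linarith
  | @skip E E' i j h hij hmax hskip ih =>
    obtain ⟨S, hES, hSE, hS, hle⟩ := ih
    have heE : s(i, j) ∉ E := Finset.disjoint_right.mp h.disjoint hij
    by_cases he : s(i, j) ∈ S
    · have hmono : ∀ {S' : Finset (Sym2 V)}, S' ⊆ S →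
          (SimpleGraph.fromEdgeSet (S' : Set (Sym2 V))).IsAcyclic := fun hS' =>
        hS.anti (SimpleGraph.fromEdgeSet_mono (by exact_mod_cast hS'))
      -- Since `S` is a forest containing `E` and the skipped pair, no loop was the reason for
      -- skipping; deleting the pair then loses no weight.
      have hw : w i j ≤ 0 := by
        by_contra! hw
        exact hskip ⟨hw, hmono (Finset.insert_subset he hES)⟩
      refine ⟨S.erase s(i, j), by grind, by grind, hmono (Finset.erase_subset _ _), ?_⟩
      have := Finset.add_sum_erase S W he
      rw [hW] at this
      linarith
    · exact ⟨S, hES, by grind, hS, hle⟩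

/-- An output of the algorithm is a forest of maximal total weight. -/
lemma IsChowLiuOutput.sum_le {W : Sym2 V → ℝ} (hW : ∀ i j, W s(i, j) = w i j)
    (h : IsChowLiuOutput w E) {T : Finset (Sym2 V)} (hdiag : ∀ e ∈ T, ¬ e.IsDiag)
    (hT : (SimpleGraph.fromEdgeSet (T : Set (Sym2 V))).IsAcyclic) :
    ∑ e ∈ T, W e ≤ ∑ e ∈ E, W e := by
  obtain ⟨S, hES, hSE, -, hle⟩ := ChowLiuState.exists_heavier hW hdiag hT h
  rw [Finset.union_empty] at hSE
  rwa [hES.antisymm hSE]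

end Algorithm

/-! ### Gibbs' inequality with its equality case. -/

section Gibbs

variable {ι : Type*} [Fintype ι] {p q : ι → ℝ}

/-- This is `log r ≤ r - 1` at `r = t / s`. The hypothesis `hst` excludes `t = 0 < s`, where the
convention `Real.log 0 = 0` would break the bound. -/
lemma mul_log_sub_mul_log_le {s t : ℝ} (hs : 0 ≤ s) (ht : 0 ≤ t) (hst : t = 0 → s = 0) :
    s * Real.log t - s * Real.log s ≤ t - s := by
  rcases hs.eq_or_lt with rfl | hs
  · simpa using ht
  have ht : 0 < t := ht.lt_of_ne fun h => hs.ne' (hst h.symm)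
  have h := mul_le_mul_of_nonneg_left (Real.log_le_sub_one_of_pos (div_pos ht hs)) hs.le
  rw [Real.log_div ht.ne' hs.ne', mul_sub, mul_sub, mul_div_cancel₀ _ hs.ne'] at h
  linarith

lemma eq_of_mul_log_sub_mul_log_eq {s t : ℝ} (hs : 0 ≤ s) (ht : 0 ≤ t) (hst : t = 0 → s = 0)
    (h : s * Real.log t - s * Real.log s = t - s) : s = t := by
  rcases hs.eq_or_lt with rfl | hs
  · simpa using h
  have ht : 0 < t := ht.lt_of_ne fun h => hs.ne' (hst h.symm)
  by_contra hne
  have h' := mul_lt_mul_of_pos_left (Real.log_lt_sub_one_of_pos (div_pos ht hs)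
    (fun h1 => hne ((div_eq_one_iff_eq hs.ne').mp h1).symm)) hs
  rw [Real.log_div ht.ne' hs.ne', mul_sub, mul_sub, mul_div_cancel₀ _ hs.ne'] at h'
  linarith

/-- **Gibbs' inequality**. -/
lemma sum_mul_log_le (hp : ∀ x, 0 ≤ p x) (hq : ∀ x, 0 ≤ q x) (hpq : ∀ x, q x = 0 → p x = 0)
    (hsum : ∑ x, q x ≤ ∑ x, p x) : ∑ x, p x * Real.log (q x) ≤ ∑ x, p x * Real.log (p x) := by
  have h := Finset.sum_le_sum fun x (_ : x ∈ Finset.univ) =>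
    mul_log_sub_mul_log_le (hp x) (hq x) (hpq x)
  rw [Finset.sum_sub_distrib, Finset.sum_sub_distrib] at h
  linarith

/-- The equality case of Gibbs' inequality. -/
lemma eq_of_sum_mul_log_le (hp : ∀ x, 0 ≤ p x) (hq : ∀ x, 0 ≤ q x) (hpq : ∀ x, q x = 0 → p x = 0)
    (hsum : ∑ x, q x ≤ ∑ x, p x)
    (hle : ∑ x, p x * Real.log (p x) ≤ ∑ x, p x * Real.log (q x)) : p = q := by
  have hterm := fun x (_ : x ∈ Finset.univ) => mul_log_sub_mul_log_le (hp x) (hq x) (hpq x)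
  have h : ∑ x, (p x * Real.log (q x) - p x * Real.log (p x)) = ∑ x, (q x - p x) := by
    refine le_antisymm (Finset.sum_le_sum hterm) ?_
    rw [Finset.sum_sub_distrib, Finset.sum_sub_distrib]
    linarith
  funext x
  exact eq_of_mul_log_sub_mul_log_eq (hp x) (hq x) (hpq x)
    ((Finset.sum_eq_sum_iff_of_le hterm).mp h x (Finset.mem_univ x))

end Gibbs

/-! ### Summing out one coordinate. -/

section Update

variable {V : Type*} {A : V → Type*} [Fintype V] [DecidableEq V] [∀ i, Fintype (A i)]

/-- To compare two sums over configurations, it is enough to compare the partial sums over one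
coordinate, up to a nonnegative factor that does not depend on that coordinate. -/
lemma sum_mul_le_sum_mul_of_update (v : V) {h k k' : (∀ i, A i) → ℝ}
    (hnn : ∀ x, 0 ≤ h x) (hupd : ∀ x u, h (Function.update x v u) = h x)
    (hk : ∀ x, ∑ u, k (Function.update x v u) ≤ ∑ u, k' (Function.update x v u)) :
    ∑ x, h x * k x ≤ ∑ x, h x * k' x := by
  rcases isEmpty_or_nonempty (A v) with hA | ⟨⟨u₀⟩⟩
  · have : IsEmpty (∀ i, A i) := ⟨fun x => hA.elim (x v)⟩
    simp
  set φ := (Equiv.piSplitAt v A).symm with hφ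
  have hφu : ∀ u y, φ (u, y) = Function.update (φ (u₀, y)) v u := by
    intro u y
    funext i
    by_cases hi : i = v
    · subst hi
      simp [hφ, Equiv.piSplitAt]
    · simp [hφ, Equiv.piSplitAt, hi]
  have key : ∀ f : (∀ i, A i) → ℝ, ∑ x, h x * f x =
      ∑ y, h (φ (u₀, y)) * ∑ u, f (Function.update (φ (u₀, y)) v u) := by
    intro f
    rw [← φ.sum_comp, Fintype.sum_prod_type_right]
    refine Finset.sum_congr rfl fun y _ => ?_
    rw [Finset.mul_sum]
    refine Finset.sum_congr rfl fun u _ => ?_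
    rw [hφu, hupd]
  rw [key, key]
  exact Finset.sum_le_sum fun y _ => mul_le_mul_of_nonneg_left (hk _) (hnn _)

end Update

/-! ### Forest densities, mutual information and true forests. -/

section Model

variable {V : Type*} {A : V → Type*} [∀ i, MeasurableSpace (A i)] (P : Measure (∀ i, A i))

lemma marginal_nonneg (i : V) (u : A i) : 0 ≤ marginal P i u := measureReal_nonneg

lemma pairMarginal_nonneg (i j : V) (u : A i) (v : A j) : 0 ≤ pairMarginal P i j u v :=
  measureReal_nonneg

lemma pairMarginal_comm (i j : V) (u : A i) (v : A j) :
    pairMarginal P i j u v = pairMarginal P j i v u := by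
  simp only [pairMarginal, and_comm]

lemma edgeFactor_nonneg (x : ∀ i, A i) (e : Sym2 V) : 0 ≤ edgeFactor P x e := by
  induction e with
  | h i j =>
    exact div_nonneg (pairMarginal_nonneg _ _ _ _ _)
      (mul_nonneg (marginal_nonneg _ _ _) (marginal_nonneg _ _ _))

lemma mutualInfo_comm [∀ i, Fintype (A i)] (i j : V) : mutualInfo P i j = mutualInfo P j i := by
  rw [mutualInfo, mutualInfo, Finset.sum_comm]
  simp only [pairMarginal_comm P i j, mul_comm (marginal P i _)]

/-- The mutual information as a function of the unordered pair. -/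
noncomputable def edgeInfo [∀ i, Fintype (A i)] : Sym2 V → ℝ :=
  Sym2.lift ⟨mutualInfo P, mutualInfo_comm P⟩

lemma edgeFactor_update [DecidableEq V] {e : Sym2 V} {v : V} (hv : v ∉ e) (x : ∀ i, A i) (u : A v) :
    edgeFactor P (Function.update x v u) e = edgeFactor P x e := by
  induction e with
  | h i j =>
    have hi : i ≠ v := fun h => hv (by simp [h])
    have hj : j ≠ v := fun h => hv (by simp [h])
    simp [edgeFactor, hi, hj]

/-- The function `∏_{i ∈ V} P(x_i) ∏_{{i,j} ∈ E} P(x_i, x_j) / (P(x_i) P(x_j))`. -/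
noncomputable def forestDensity [Fintype V] (E : Finset (Sym2 V)) (x : ∀ i, A i) : ℝ :=
  (∏ i, marginal P i (x i)) * ∏ e ∈ E, edgeFactor P x e

lemma forestDensity_nonneg [Fintype V] (E : Finset (Sym2 V)) (x : ∀ i, A i) : 0 ≤ forestDensity P E x :=
  mul_nonneg (Finset.prod_nonneg fun _ _ => marginal_nonneg _ _ _)
    (Finset.prod_nonneg fun _ _ => edgeFactor_nonneg _ _ _)

variable [IsProbabilityMeasure P]

lemma pairMarginal_le_left (i j : V) (u : A i) (v : A j) :
    pairMarginal P i j u v ≤ marginal P i u :=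
  measureReal_mono fun _ h => h.1

lemma pairMarginal_le_right (i j : V) (u : A i) (v : A j) :
    pairMarginal P i j u v ≤ marginal P j v :=
  measureReal_mono fun _ h => h.2

/-- On the support of `P` no marginal and no pair marginal vanishes, so logarithms of products split
there; elsewhere the weight `P.real {x}` is zero. -/
lemma real_singleton_le_pairMarginal (x : ∀ i, A i) (i j : V) :
    P.real {x} ≤ pairMarginal P i j (x i) (x j) :=
  measureReal_mono fun y h => by
    rw [Set.mem_singleton_iff.mp h]
    exact ⟨rfl, rfl⟩

lemma real_singleton_le_marginal (x : ∀ i, A i) (i : V) : P.real {x} ≤ marginal P i (x i) :=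
  (real_singleton_le_pairMarginal P x i i).trans (pairMarginal_le_left P i i _ _)

lemma edgeFactor_pos {x : ∀ i, A i} (hx : 0 < P.real {x}) (e : Sym2 V) :
    0 < edgeFactor P x e := by
  induction e with
  | h i j =>
    exact div_pos (hx.trans_le (real_singleton_le_pairMarginal P x i j))
      (mul_pos (hx.trans_le (real_singleton_le_marginal P x i))
        (hx.trans_le (real_singleton_le_marginal P x j)))

lemma pairMarginal_eq_zero_of_marginal_mul_eq_zero {i j : V} {u : A i} {v : A j}
    (h : marginal P i u * marginal P j v = 0) : pairMarginal P i j u v = 0 := by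
  refine le_antisymm ?_ (pairMarginal_nonneg P i j u v)
  rcases mul_eq_zero.mp h with h | h
  · exact h ▸ pairMarginal_le_left P i j u v
  · exact h ▸ pairMarginal_le_right P i j u v

lemma mutualInfo_eq_sub [∀ i, Fintype (A i)] (i j : V) :
    mutualInfo P i j =
      ∑ z : A i × A j, pairMarginal P i j z.1 z.2 * Real.log (pairMarginal P i j z.1 z.2) -
      ∑ z : A i × A j,
        pairMarginal P i j z.1 z.2 * Real.log (marginal P i z.1 * marginal P j z.2) := by
  rw [mutualInfo, ← Finset.sum_sub_distrib, Fintype.sum_prod_type]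
  refine Finset.sum_congr rfl fun u _ => Finset.sum_congr rfl fun v _ => ?_
  rcases (pairMarginal_nonneg P i j u v).eq_or_lt with h | h
  · simp [← h]
  · rw [Real.log_div h.ne' (mul_pos (h.trans_le (pairMarginal_le_left P i j u v))
      (h.trans_le (pairMarginal_le_right P i j u v))).ne', mul_sub]

lemma forestDensity_pos [Fintype V] (E : Finset (Sym2 V)) {x : ∀ i, A i} (hx : 0 < P.real {x}) :
    0 < forestDensity P E x :=
  mul_pos (Finset.prod_pos fun i _ => hx.trans_le (real_singleton_le_marginal P x i))
    (Finset.prod_pos fun _ _ => edgeFactor_pos P hx _)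

variable [Fintype V] [DecidableEq V] [∀ i, Fintype (A i)] [∀ i, MeasurableSingletonClass (A i)]

lemma real_eq_sum_filter (p : (∀ i, A i) → Prop) [DecidablePred p] :
    P.real {x | p x} = ∑ x with p x, P.real {x} := by
  rw [sum_measureReal_singleton]
  simp

lemma sum_real_singleton : ∑ x : ∀ i, A i, P.real {x} = 1 := by
  rw [sum_measureReal_singleton]
  simp

variable [∀ i, DecidableEq (A i)]

lemma sum_marginal_mul (i : V) (g : A i → ℝ) :
    ∑ u, marginal P i u * g u = ∑ x : ∀ i, A i, P.real {x} * g (x i) := by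
  rw [← Finset.sum_fiberwise (s := Finset.univ) (g := fun x : ∀ i, A i => x i)]
  refine Finset.sum_congr rfl fun u _ => ?_
  rw [marginal, real_eq_sum_filter, Finset.sum_mul]
  refine Finset.sum_congr rfl fun x hx => ?_
  rw [(Finset.mem_filter.mp hx).2]

lemma sum_pairMarginal_mul (i j : V) (g : A i → A j → ℝ) :
    ∑ u, ∑ v, pairMarginal P i j u v * g u v =
      ∑ x : ∀ i, A i, P.real {x} * g (x i) (x j) := by
  rw [← Finset.sum_fiberwise (s := Finset.univ) (g := fun x : ∀ i, A i => (x i, x j)),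
    Fintype.sum_prod_type]
  refine Finset.sum_congr rfl fun u _ => Finset.sum_congr rfl fun v _ => ?_
  rw [pairMarginal, real_eq_sum_filter, Finset.sum_mul]
  simp only [Prod.mk.injEq]
  refine Finset.sum_congr rfl fun x hx => ?_
  rw [(Finset.mem_filter.mp hx).2.1, (Finset.mem_filter.mp hx).2.2]

lemma sum_marginal (i : V) : ∑ u, marginal P i u = 1 := by
  simpa [sum_real_singleton] using sum_marginal_mul P i fun _ => 1

lemma sum_pairMarginal_right (i j : V) (u : A i) :
    ∑ v, pairMarginal P i j u v = marginal P i u := by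
  have h := sum_pairMarginal_mul P i j fun u' _ => if u' = u then 1 else 0
  rw [← sum_marginal_mul P i fun u' => if u' = u then 1 else 0] at h
  simp only [mul_ite, mul_one, mul_zero] at h
  rw [Finset.sum_comm] at h
  simpa using h

lemma sum_pairMarginal_left (i j : V) (v : A j) :
    ∑ u, pairMarginal P i j u v = marginal P j v := by
  simp_rw [pairMarginal_comm P i j]
  exact sum_pairMarginal_right P j i v

lemma sum_marginal_mul_le_sum_pairMarginal (i j : V) :
    ∑ z : A i × A j, marginal P i z.1 * marginal P j z.2 ≤
      ∑ z : A i × A j, pairMarginal P i j z.1 z.2 := by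
  simp only [Fintype.sum_prod_type, sum_pairMarginal_right, ← Finset.mul_sum, sum_marginal,
    mul_one, le_refl]

lemma mutualInfo_nonneg (i j : V) : 0 ≤ mutualInfo P i j := by
  rw [mutualInfo_eq_sub, sub_nonneg]
  exact sum_mul_log_le (fun _ => pairMarginal_nonneg _ _ _ _ _)
    (fun _ => mul_nonneg (marginal_nonneg _ _ _) (marginal_nonneg _ _ _))
    (fun _ => pairMarginal_eq_zero_of_marginal_mul_eq_zero P)
    (sum_marginal_mul_le_sum_pairMarginal P i j)

/-- Variables with vanishing mutual information are independent. -/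
lemma pairMarginal_eq_mul_of_mutualInfo_eq_zero {i j : V} (h : mutualInfo P i j = 0) (u : A i)
    (v : A j) : pairMarginal P i j u v = marginal P i u * marginal P j v := by
  rw [mutualInfo_eq_sub, sub_eq_zero] at h
  exact congrFun (eq_of_sum_mul_log_le (fun _ => pairMarginal_nonneg _ _ _ _ _)
    (fun _ => mul_nonneg (marginal_nonneg _ _ _) (marginal_nonneg _ _ _))
    (fun _ => pairMarginal_eq_zero_of_marginal_mul_eq_zero P)
    (sum_marginal_mul_le_sum_pairMarginal P i j) h.le) (u, v)

lemma sum_mul_log_edgeFactor (e : Sym2 V) :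
    ∑ x : ∀ i, A i, P.real {x} * Real.log (edgeFactor P x e) = edgeInfo P e := by
  induction e with
  | h i j =>
    exact (sum_pairMarginal_mul P i j fun u v =>
      Real.log (pairMarginal P i j u v / (marginal P i u * marginal P j v))).symm

/-- The first sum on the right does not involve `E`, so maximizing the expected log-likelihood over
forests is a maximum-weight forest problem. -/
lemma sum_mul_log_forestDensity (E : Finset (Sym2 V)) :
    ∑ x, P.real {x} * Real.log (forestDensity P E x) =
      ∑ x : ∀ i, A i, P.real {x} * ∑ i, Real.log (marginal P i (x i)) +
        ∑ e ∈ E, edgeInfo P e := by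
  simp_rw [← sum_mul_log_edgeFactor P]
  rw [Finset.sum_comm, ← Finset.sum_add_distrib]
  refine Finset.sum_congr rfl fun x _ => ?_
  rcases (measureReal_nonneg (μ := P) (s := {x})).eq_or_lt with h | h
  · simp [← h]
  · have h1 : ∀ i, marginal P i (x i) ≠ 0 := fun i =>
      (h.trans_le (real_singleton_le_marginal P x i)).ne'
    have h2 : ∀ e, edgeFactor P x e ≠ 0 := fun e => (edgeFactor_pos P h e).ne'
    rw [forestDensity, Real.log_mul (Finset.prod_ne_zero_iff.mpr fun i _ => h1 i)
      (Finset.prod_ne_zero_iff.mpr fun e _ => h2 e), Real.log_prod fun i _ => h1 i,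
      Real.log_prod fun e _ => h2 e, mul_add, Finset.mul_sum (s := E)]

/-- The sum is that of the conditional probabilities given `x w`. It is only bounded by one because
division by zero makes it vanish when `x w` has probability zero. -/
lemma sum_marginal_mul_edgeFactor_le {v w : V} (hvw : w ≠ v) (x : ∀ i, A i) :
    ∑ u, marginal P v u * edgeFactor P (Function.update x v u) s(v, w) ≤ 1 := by
  have h : ∀ u, marginal P v u * edgeFactor P (Function.update x v u) s(v, w) ≤
      pairMarginal P v w u (x w) / marginal P w (x w) := by
    intro u
    simp only [edgeFactor, Sym2.lift_mk, Function.update_self, Function.update_of_ne hvw]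
    rcases (marginal_nonneg P v u).eq_or_lt with h | h
    · rw [← h, zero_mul]
      exact div_nonneg (pairMarginal_nonneg _ _ _ _ _) (marginal_nonneg _ _ _)
    · rw [mul_div_assoc', mul_div_mul_left _ _ h.ne']
  refine (Finset.sum_le_sum fun u _ => h u).trans ?_
  rw [← Finset.sum_div, sum_pairMarginal_left]
  exact div_self_le_one _

/-- The total mass does not decrease if the edge at a leaf is removed. -/
lemma sum_forestDensity_le_of_leaf {E : Finset (Sym2 V)} {v w : V} (hvw : w ≠ v)
    (he : s(v, w) ∈ E) (hleaf : ∀ e ∈ E, v ∈ e → e = s(v, w)) :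
    ∑ x, forestDensity P E x ≤ ∑ x, forestDensity P (E.erase s(v, w)) x := by
  have hv : v ∈ (Finset.univ : Finset V) := Finset.mem_univ v
  set h : (∀ i, A i) → ℝ := fun x =>
    (∏ i ∈ Finset.univ.erase v, marginal P i (x i)) *
      ∏ e ∈ E.erase s(v, w), edgeFactor P x e with hh
  have h1 : ∀ x, forestDensity P E x =
      h x * (marginal P v (x v) * edgeFactor P x s(v, w)) := by
    intro x
    rw [forestDensity, ← Finset.mul_prod_erase _ _ hv, ← Finset.mul_prod_erase _ _ he]
    ring
  have h2 : ∀ x, forestDensity P (E.erase s(v, w)) x = h x * marginal P v (x v) := by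
    intro x
    rw [forestDensity, ← Finset.mul_prod_erase _ _ hv]
    ring
  simp_rw [h1, h2]
  refine sum_mul_le_sum_mul_of_update v (fun x => ?_) (fun x u => ?_) fun x => ?_
  · exact mul_nonneg (Finset.prod_nonneg fun _ _ => marginal_nonneg _ _ _)
      (Finset.prod_nonneg fun _ _ => edgeFactor_nonneg _ _ _)
  · simp only [hh]
    congr 1
    · refine Finset.prod_congr rfl fun i hi => ?_
      rw [Function.update_of_ne (Finset.ne_of_mem_erase hi)]
    · refine Finset.prod_congr rfl fun e he' => edgeFactor_update P (fun hve => ?_) x u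
      exact Finset.ne_of_mem_erase he' (hleaf e (Finset.mem_of_mem_erase he') hve)
  · simp only [Function.update_self, sum_marginal]
    exact sum_marginal_mul_edgeFactor_le P hvw x

/-- Peeling off leaves reduces the forest to the product of the marginals, which has mass one.
Gibbs' inequality needs only the upper bound. -/
lemma sum_forestDensity_le_one {E : Finset (Sym2 V)} (hdiag : ∀ e ∈ E, ¬ e.IsDiag)
    (hE : (SimpleGraph.fromEdgeSet (E : Set (Sym2 V))).IsAcyclic) :
    ∑ x, forestDensity P E x ≤ 1 := by
  induction hn : E.card generalizing E with
  | zero =>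
    rw [Finset.card_eq_zero] at hn
    subst hn
    simp only [forestDensity, Finset.prod_empty, mul_one]
    rw [← Fintype.piFinset_univ, ← Finset.prod_univ_sum]
    simp [sum_marginal]
  | succ n ih =>
    obtain ⟨e, he⟩ := Finset.card_pos.mp (by omega : 0 < E.card)
    have hadj : ∃ u v, (SimpleGraph.fromEdgeSet (E : Set (Sym2 V))).Adj u v := by
      induction e with
      | h u v => exact ⟨u, v, by simpa using ⟨he, by simpa using hdiag _ he⟩⟩
    obtain ⟨u, v, huv⟩ := hadj
    obtain ⟨x, y, hxy, hleaf⟩ := exists_leaf hE huv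
    rw [SimpleGraph.fromEdgeSet_adj] at hxy
    have hmem : s(x, y) ∈ E := by simpa using hxy.1
    refine (sum_forestDensity_le_of_leaf P hxy.2.symm hmem ?_).trans
      (ih (fun e he => hdiag e (Finset.mem_of_mem_erase he)) (hE.anti
        (SimpleGraph.fromEdgeSet_mono (by exact_mod_cast Finset.erase_subset _ _))) ?_)
    · intro e he hxe
      obtain ⟨z, rfl⟩ := Sym2.mem_iff_exists.mp hxe
      rw [hleaf z (by simpa using ⟨he, by simpa using hdiag _ he⟩)]
    · rw [Finset.card_erase_of_mem hmem]
      omega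

/-- The left side does not involve `T`: all forests along which `P` factors have the same total
mutual information. -/
lemma sum_mul_log_of_factorsAlongForest {T : Finset (Sym2 V)} (hT : FactorsAlongForest P T) :
    ∑ x : ∀ i, A i, P.real {x} * Real.log (P.real {x}) =
      ∑ x : ∀ i, A i, P.real {x} * ∑ i, Real.log (marginal P i (x i)) +
        ∑ e ∈ T, edgeInfo P e := by
  rw [← sum_mul_log_forestDensity]
  exact Finset.sum_congr rfl fun x _ => congrArg (P.real {x} * Real.log ·) (hT.2.2 x)

/-- If the distribution factors along some forest, then every output of the algorithm with the
true mutual informations as weights is a true forest. -/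
lemma isTrueForest_of_isChowLiuOutput {E T : Finset (Sym2 V)} (hT : FactorsAlongForest P T)
    (hE : IsChowLiuOutput (mutualInfo P) E) : IsTrueForest P E := by
  have hW : ∀ i j, edgeInfo P s(i, j) = mutualInfo P i j := fun _ _ => rfl
  have hEd : ∀ e ∈ E, ¬ e.IsDiag := ChowLiuState.not_isDiag hE
  have hEa := ChowLiuState.isAcyclic hE
  have hle := hE.sum_le hW hT.1 hT.2.1
  have hfac : (fun x => P.real {x}) = forestDensity P E := by
    refine eq_of_sum_mul_log_le (fun _ => measureReal_nonneg) (forestDensity_nonneg P E)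
      (fun x hx => ?_) ?_ ?_
    · by_contra hne
      exact (forestDensity_pos P E (measureReal_nonneg.lt_of_ne' hne)).ne' hx
    · rw [sum_real_singleton]
      exact sum_forestDensity_le_one P hEd hEa
    · rw [sum_mul_log_of_factorsAlongForest P hT, sum_mul_log_forestDensity]
      linarith
  have hEF : FactorsAlongForest P E := ⟨hEd, hEa, fun x => congrFun hfac x⟩
  refine ⟨hEF, fun F hF hFE => ?_⟩
  -- A proper subforest along which `P` factors would weigh as much as `E`, although it lacks an
  -- edge of positive weight.
  have h1 := sum_mul_log_of_factorsAlongForest P hF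
  rw [sum_mul_log_of_factorsAlongForest P hEF] at h1
  by_contra hne
  obtain ⟨e, heE, heF⟩ := Finset.not_subset.mp hne
  have hpos := ChowLiuState.weight_pos hW hE
  have := Finset.sum_lt_sum_of_subset hFE heE heF (hpos e heE) fun f hf _ => (hpos f hf).le
  linarith

end Model

/-! ### Stirling asymptotics of Bayes measures. -/

section Stirling

/-- Stirling's formula for `Γ(n + a)`, up to a bounded error. -/
lemma exists_abs_log_Gamma_nat_add_le {a : ℝ} (ha : 0 < a) :
    ∃ C, ∀ n : ℕ, |Real.log (Real.Gamma (n + a)) -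
      (n * Real.log n - n + (a - 1 / 2) * Real.log n)| ≤ C := by
  have h1 : Tendsto (fun n : ℕ => Real.log (Real.Gamma a) - Real.BohrMollerup.logGammaSeq a n)
      atTop (nhds (Real.log (Real.Gamma a) - Real.log (Real.Gamma a))) :=
    tendsto_const_nhds.sub (Real.BohrMollerup.tendsto_log_gamma ha)
  have h2 : Tendsto (fun n : ℕ => Real.log (1 + a / n)) atTop (nhds (Real.log (1 + 0))) := by
    refine Tendsto.log ?_ (by norm_num)
    exact tendsto_const_nhds.add (tendsto_const_div_atTop_nhds_zero_nat a)
  have h3 : Tendsto (fun n : ℕ => Real.log (Stirling.stirlingSeq n)) atTop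
      (nhds (Real.log (√Real.pi))) :=
    Stirling.tendsto_stirlingSeq_sqrt_pi.log (by positivity)
  -- The first limit compares `Γ(n + 1 + a)` with `n! * n ^ a`, the second passes to `Γ(n + a)`, the
  -- third replaces `n!`; the constant removes the `√2` in `stirlingSeq`.
  have h4 := ((h1.sub h2).add h3).add_const (1 / 2 * Real.log 2)
  have h5 : ∃ L, Tendsto (fun n : ℕ => Real.log (Real.Gamma (n + a)) -
      (n * Real.log n - n + (a - 1 / 2) * Real.log n)) atTop (nhds L) := by
    refine ⟨_, h4.congr' ?_⟩
    filter_upwards [eventually_gt_atTop 0] with n hn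
    have hn' : (0 : ℝ) < n := Nat.cast_pos.mpr hn
    have e1 : Real.log (Real.Gamma (a + ((n + 1 : ℕ) : ℝ))) = Real.log (Real.Gamma a) +
        ∑ m ∈ Finset.range (n + 1), Real.log (a + m) :=
      Real.BohrMollerup.f_add_nat_eq (f := fun x => Real.log (Real.Gamma x))
        (fun {y} hy => by
          rw [Real.Gamma_add_one hy.ne', Real.log_mul hy.ne' (Real.Gamma_pos_of_pos hy).ne',
            add_comm]) ha (n + 1)
    have e2 : Real.log (Real.Gamma (a + ((n + 1 : ℕ) : ℝ))) =
        Real.log (n + a) + Real.log (Real.Gamma (n + a)) := by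
      have hpos : 0 < (n : ℝ) + a := by positivity
      rw [← Real.log_mul hpos.ne' (Real.Gamma_pos_of_pos hpos).ne', ← Real.Gamma_add_one hpos.ne']
      push_cast
      ring_nf
    have e3 : Real.log (1 + a / n) = Real.log (n + a) - Real.log n := by
      rw [← Real.log_div (by positivity) hn'.ne', add_div, div_self hn'.ne']
    have e4 := Stirling.log_stirlingSeq_formula n
    rw [Real.log_mul two_ne_zero hn'.ne', Real.log_div hn'.ne' (Real.exp_ne_zero 1),
      Real.log_exp] at e4
    rw [Real.BohrMollerup.logGammaSeq, e3, e4]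
    linarith
  obtain ⟨L, h5⟩ := h5
  obtain ⟨C, hC⟩ := (Metric.isBounded_range_of_tendsto _ h5).exists_norm_le
  exact ⟨C, fun n => hC _ ⟨n, rfl⟩⟩

variable {α : Type*} [Fintype α]

lemma bayesMeasure_pos [Nonempty α] {a : α → ℝ} (ha : ∀ x, 0 < a x) (c : α → ℕ) :
    0 < bayesMeasure a c := by
  have h1 : 0 < ∑ x, a x := Finset.sum_pos (fun x _ => ha x) Finset.univ_nonempty
  have h2 : 0 < ∑ x, ((c x : ℝ) + a x) :=
    Finset.sum_pos (fun x _ => add_pos_of_nonneg_of_pos (Nat.cast_nonneg _) (ha x))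
      Finset.univ_nonempty
  refine mul_pos (div_pos (Real.Gamma_pos_of_pos h1) (Real.Gamma_pos_of_pos h2))
    (Finset.prod_pos fun x _ => div_pos (Real.Gamma_pos_of_pos ?_) (Real.Gamma_pos_of_pos (ha x)))
  exact add_pos_of_nonneg_of_pos (Nat.cast_nonneg _) (ha x)

/-- Stirling's formula is applied to each Gamma factor; the linear terms cancel because the counts
add up to the total. Empty cells fit in because `Real.log 0 = 0`, so `C` is uniform in `c`. -/
lemma exists_abs_log_bayesMeasure_le [Nonempty α] {a : α → ℝ} (ha : ∀ x, 0 < a x) :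
    ∃ C, ∀ c : α → ℕ, |Real.log (bayesMeasure a c) -
      (∑ x, ((c x : ℝ) * Real.log (c x) + (a x - 1 / 2) * Real.log (c x)) -
        (((∑ x, c x : ℕ) : ℝ) * Real.log ((∑ x, c x : ℕ) : ℝ) +
          (∑ x, a x - 1 / 2) * Real.log ((∑ x, c x : ℕ) : ℝ)))| ≤ C := by
  have hs : 0 < ∑ x, a x := Finset.sum_pos (fun x _ => ha x) Finset.univ_nonempty
  choose C hC using fun x => exists_abs_log_Gamma_nat_add_le (ha x)
  obtain ⟨D, hD⟩ := exists_abs_log_Gamma_nat_add_le hs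
  refine ⟨∑ x, C x + D + |Real.log (Real.Gamma (∑ x, a x))| + |∑ x, Real.log (Real.Gamma (a x))|,
    fun c => ?_⟩
  have hpos : ∀ x, 0 < (c x : ℝ) + a x :=
    fun x => add_pos_of_nonneg_of_pos (Nat.cast_nonneg _) (ha x)
  have hsum : ∑ x, ((c x : ℝ) + a x) = ((∑ x, c x : ℕ) : ℝ) + ∑ x, a x := by
    rw [Finset.sum_add_distrib]
    push_cast
    ring
  have hG : ∀ {t : ℝ}, 0 < t → Real.Gamma t ≠ 0 := fun ht => (Real.Gamma_pos_of_pos ht).ne'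
  have hlog : Real.log (bayesMeasure a c) = Real.log (Real.Gamma (∑ x, a x)) -
      Real.log (Real.Gamma (((∑ x, c x : ℕ) : ℝ) + ∑ x, a x)) +
      (∑ x, Real.log (Real.Gamma ((c x : ℝ) + a x)) - ∑ x, Real.log (Real.Gamma (a x))) := by
    have hN : 0 < ((∑ x, c x : ℕ) : ℝ) + ∑ x, a x :=
      add_pos_of_nonneg_of_pos (Nat.cast_nonneg _) hs
    rw [bayesMeasure, hsum, Real.log_mul (div_ne_zero (hG hs) (hG hN))
      (Finset.prod_ne_zero_iff.mpr fun x _ => div_ne_zero (hG (hpos x)) (hG (ha x))),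
      Real.log_div (hG hs) (hG hN),
      Real.log_prod fun x _ => div_ne_zero (hG (hpos x)) (hG (ha x)), ← Finset.sum_sub_distrib]
    congr 1
    exact Finset.sum_congr rfl fun x _ => Real.log_div (hG (hpos x)) (hG (ha x))
  have h1 : |∑ x, (Real.log (Real.Gamma ((c x : ℝ) + a x)) -
      ((c x : ℝ) * Real.log (c x) - c x + (a x - 1 / 2) * Real.log (c x)))| ≤ ∑ x, C x :=
    (Finset.abs_sum_le_sum_abs _ _).trans (Finset.sum_le_sum fun x _ => hC x (c x))
  have h2 := hD (∑ x, c x)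
  have h3 : ∑ x, (Real.log (Real.Gamma ((c x : ℝ) + a x)) -
      ((c x : ℝ) * Real.log (c x) - c x + (a x - 1 / 2) * Real.log (c x))) =
      ∑ x, Real.log (Real.Gamma ((c x : ℝ) + a x)) -
        ∑ x, ((c x : ℝ) * Real.log (c x) + (a x - 1 / 2) * Real.log (c x)) +
        ((∑ x, c x : ℕ) : ℝ) := by
    push_cast
    rw [← Finset.sum_sub_distrib, ← Finset.sum_add_distrib]
    exact Finset.sum_congr rfl fun x _ => by ring
  rw [h3, abs_le] at h1
  rw [abs_le] at h2
  rw [hlog, abs_le]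
  have h4 := abs_le.mp (le_refl |Real.log (Real.Gamma (∑ x, a x))|)
  have h5 := abs_le.mp (le_refl |∑ x, Real.log (Real.Gamma (a x))|)
  constructor <;> linarith [h1.1, h1.2, h2.1, h2.2, h4.1, h4.2, h5.1, h5.2]

end Stirling

/-! ### Bayes factors of contingency tables. -/

section Counts

variable {α β : Type*} [Fintype α] [Fintype β]

/-- The logarithm of the Bayes factor of the contingency table `c`. -/
noncomputable def logBayesFactor (a : α → ℝ) (a' : β → ℝ) (b : α × β → ℝ) (c : α × β → ℕ) : ℝ :=
  Real.log (bayesMeasure b c /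
    (bayesMeasure a (fun u => ∑ v, c (u, v)) * bayesMeasure a' (fun v => ∑ u, c (u, v))))

/-- The sample size times the empirical mutual information. -/
noncomputable def empiricalInfo (c : α × β → ℕ) : ℝ :=
  ∑ z, (c z : ℝ) * Real.log (c z) -
    ∑ u, ((∑ v, c (u, v) : ℕ) : ℝ) * Real.log ((∑ v, c (u, v) : ℕ) : ℝ) -
    ∑ v, ((∑ u, c (u, v) : ℕ) : ℝ) * Real.log ((∑ u, c (u, v) : ℕ) : ℝ) +
    ((∑ z, c z : ℕ) : ℝ) * Real.log ((∑ z, c z : ℕ) : ℝ)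

/-- The logarithmic penalty in the Bayes factor. -/
noncomputable def logPenalty (a : α → ℝ) (a' : β → ℝ) (b : α × β → ℝ) (c : α × β → ℕ) : ℝ :=
  ∑ z, (b z - 1 / 2) * Real.log (c z) -
    ∑ u, (a u - 1 / 2) * Real.log ((∑ v, c (u, v) : ℕ) : ℝ) -
    ∑ v, (a' v - 1 / 2) * Real.log ((∑ u, c (u, v) : ℕ) : ℝ) +
    (∑ u, a u + ∑ v, a' v - ∑ z, b z - 1 / 2) * Real.log ((∑ z, c z : ℕ) : ℝ)

variable {a : α → ℝ} {a' : β → ℝ} {b : α × β → ℝ}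

lemma exists_abs_logBayesFactor_le [Nonempty α] [Nonempty β] (ha : ∀ u, 0 < a u)
    (ha' : ∀ v, 0 < a' v) (hb : ∀ z, 0 < b z) :
    ∃ C, ∀ c : α × β → ℕ,
      |logBayesFactor a a' b c - (empiricalInfo c + logPenalty a a' b c)| ≤ C := by
  obtain ⟨C₁, h₁⟩ := exists_abs_log_bayesMeasure_le ha
  obtain ⟨C₂, h₂⟩ := exists_abs_log_bayesMeasure_le ha'
  obtain ⟨C₃, h₃⟩ := exists_abs_log_bayesMeasure_le hb
  refine ⟨C₁ + C₂ + C₃, fun c => ?_⟩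
  have k₁ := abs_le.mp (h₁ fun u => ∑ v, c (u, v))
  have k₂ := abs_le.mp (h₂ fun v => ∑ u, c (u, v))
  have k₃ := abs_le.mp (h₃ c)
  have e₁ : ∑ u, ∑ v, c (u, v) = ∑ z, c z := (Fintype.sum_prod_type c).symm
  have e₂ : ∑ v, ∑ u, c (u, v) = ∑ z, c z := (Fintype.sum_prod_type_right c).symm
  rw [e₁, Finset.sum_add_distrib] at k₁
  rw [e₂, Finset.sum_add_distrib] at k₂
  rw [Finset.sum_add_distrib] at k₃
  rw [logBayesFactor, Real.log_div (bayesMeasure_pos hb c).ne'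
    (mul_pos (bayesMeasure_pos ha _) (bayesMeasure_pos ha' _)).ne',
    Real.log_mul (bayesMeasure_pos ha _).ne' (bayesMeasure_pos ha' _).ne', empiricalInfo,
    logPenalty, abs_le]
  constructor <;> linarith [k₁.1, k₁.2, k₂.1, k₂.2, k₃.1, k₃.2]

lemma log_natCast_le_log_natCast {m n : ℕ} (h : m ≤ n) : Real.log m ≤ Real.log n := by
  rcases Nat.eq_zero_or_pos m with rfl | hm
  · simpa using Real.log_natCast_nonneg n
  · exact Real.log_le_log (by exact_mod_cast hm) (by exact_mod_cast h)

lemma sum_row_le (c : α × β → ℕ) (u : α) : ∑ v, c (u, v) ≤ ∑ z, c z := by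
  rw [Fintype.sum_prod_type]
  exact Finset.single_le_sum (f := fun u => ∑ v, c (u, v)) (fun _ _ => Nat.zero_le _)
    (Finset.mem_univ u)

lemma sum_column_le (c : α × β → ℕ) (v : β) : ∑ u, c (u, v) ≤ ∑ z, c z := by
  rw [Fintype.sum_prod_type_right]
  exact Finset.single_le_sum (f := fun v => ∑ u, c (u, v)) (fun _ _ => Nat.zero_le _)
    (Finset.mem_univ v)

lemma abs_sum_mul_log_le {κ : Type*} [Fintype κ] (d : κ → ℝ) {m : κ → ℕ} {n : ℕ}
    (hm : ∀ x, m x ≤ n) : |∑ x, d x * Real.log (m x)| ≤ (∑ x, |d x|) * Real.log n := by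
  rw [Finset.sum_mul]
  refine (Finset.abs_sum_le_sum_abs _ _).trans (Finset.sum_le_sum fun x _ => ?_)
  rw [abs_mul, abs_of_nonneg (Real.log_natCast_nonneg _)]
  exact mul_le_mul_of_nonneg_left (log_natCast_le_log_natCast (hm x)) (abs_nonneg _)

lemma exists_abs_logPenalty_le (a : α → ℝ) (a' : β → ℝ) (b : α × β → ℝ) :
    ∃ C, ∀ c : α × β → ℕ, |logPenalty a a' b c| ≤ C * Real.log ((∑ z, c z : ℕ) : ℝ) := by
  refine ⟨∑ z, |b z - 1 / 2| + ∑ u, |a u - 1 / 2| + ∑ v, |a' v - 1 / 2| +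
    |∑ u, a u + ∑ v, a' v - ∑ z, b z - 1 / 2|, fun c => ?_⟩
  have k₁ := abs_le.mp (abs_sum_mul_log_le (fun z => b z - 1 / 2) (m := c) fun z =>
    Finset.single_le_sum (fun _ _ => Nat.zero_le _) (Finset.mem_univ z))
  have k₂ := abs_le.mp (abs_sum_mul_log_le (fun u => a u - 1 / 2) (sum_row_le c))
  have k₃ := abs_le.mp (abs_sum_mul_log_le (fun v => a' v - 1 / 2) (sum_column_le c))
  have k₄ := abs_le.mp (le_refl |(∑ u, a u + ∑ v, a' v - ∑ z, b z - 1 / 2) *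
    Real.log ((∑ z, c z : ℕ) : ℝ)|)
  rw [abs_mul, abs_of_nonneg (Real.log_natCast_nonneg _)] at k₄
  rw [logPenalty, abs_le]
  constructor <;> linarith [k₁.1, k₁.2, k₂.1, k₂.2, k₃.1, k₃.2, k₄.1, k₄.2]

lemma sum_natCast_mul_log_div {κ : Type*} [Fintype κ] (m : κ → ℕ) {n : ℕ} (hn : 0 < n)
    (hm : ∑ x, m x = n) :
    (n : ℝ) * ∑ x, (m x : ℝ) / n * Real.log ((m x : ℝ) / n) =
      ∑ x, (m x : ℝ) * Real.log (m x) - n * Real.log n := by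
  have hn' : (n : ℝ) ≠ 0 := by positivity
  have h : (n : ℝ) * Real.log n = ∑ x, (m x : ℝ) * Real.log n := by
    rw [← Finset.sum_mul, ← hm]
    push_cast
    rfl
  rw [h, Finset.mul_sum, ← Finset.sum_sub_distrib]
  refine Finset.sum_congr rfl fun x _ => ?_
  rw [← mul_assoc, mul_div_cancel₀ _ hn']
  rcases Nat.eq_zero_or_pos (m x) with h0 | h0
  · simp [h0]
  · rw [Real.log_div (by positivity) hn', mul_sub]

lemma empiricalInfo_eq (c : α × β → ℕ) {n : ℕ} (hn : 0 < n) (hc : ∑ z, c z = n) :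
    empiricalInfo c = n * (∑ z, (c z : ℝ) / n * Real.log ((c z : ℝ) / n) -
      ∑ u, ((∑ v, c (u, v) : ℕ) : ℝ) / n * Real.log (((∑ v, c (u, v) : ℕ) : ℝ) / n) -
      ∑ v, ((∑ u, c (u, v) : ℕ) : ℝ) / n * Real.log (((∑ u, c (u, v) : ℕ) : ℝ) / n)) := by
  rw [mul_sub, mul_sub, sum_natCast_mul_log_div c hn hc,
    sum_natCast_mul_log_div (fun u => ∑ v, c (u, v)) hn
      ((Fintype.sum_prod_type c).symm.trans hc),
    sum_natCast_mul_log_div (fun v => ∑ u, c (u, v)) hn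
      ((Fintype.sum_prod_type_right c).symm.trans hc), empiricalInfo, hc]
  ring

variable {ι : Type*} {l : Filter ι} {c : ι → α × β → ℕ} {p : α × β → ℝ}

lemma tendsto_log_natCast_div_atTop :
    Tendsto (fun n : ℕ => Real.log n / n) atTop (nhds 0) :=
  (Real.isLittleO_log_id_atTop.tendsto_div_nhds_zero).comp tendsto_natCast_atTop_atTop

/-- If the empirical distributions converge to `p`, then the normalized logarithm of the Bayes
factor converges to the mutual information of `p`. -/
lemma tendsto_logBayesFactor_div [Nonempty α] [Nonempty β] (ha : ∀ u, 0 < a u)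
    (ha' : ∀ v, 0 < a' v) (hb : ∀ z, 0 < b z) (hN : Tendsto (fun n => ∑ z, c n z) l atTop)
    (hp : ∀ z, Tendsto (fun n => (c n z : ℝ) / (∑ z, c n z : ℕ)) l (nhds (p z))) :
    Tendsto (fun n => logBayesFactor a a' b (c n) / (∑ z, c n z : ℕ)) l
      (nhds (∑ z, p z * Real.log (p z) -
        ∑ u, (∑ v, p (u, v)) * Real.log (∑ v, p (u, v)) -
        ∑ v, (∑ u, p (u, v)) * Real.log (∑ u, p (u, v)))) := by
  obtain ⟨C, hC⟩ := exists_abs_logBayesFactor_le ha ha' hb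
  obtain ⟨D, hD⟩ := exists_abs_logPenalty_le a a' b
  have hrow : ∀ u, Tendsto (fun n => ((∑ v, c n (u, v) : ℕ) : ℝ) / (∑ z, c n z : ℕ)) l
      (nhds (∑ v, p (u, v))) := by
    intro u
    simp only [Nat.cast_sum (R := ℝ) Finset.univ fun v => c _ (u, v), Finset.sum_div]
    exact tendsto_finsetSum _ fun v _ => hp (u, v)
  have hcol : ∀ v, Tendsto (fun n => ((∑ u, c n (u, v) : ℕ) : ℝ) / (∑ z, c n z : ℕ)) l
      (nhds (∑ u, p (u, v))) := by
    intro v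
    simp only [Nat.cast_sum (R := ℝ) Finset.univ fun u => c _ (u, v), Finset.sum_div]
    exact tendsto_finsetSum _ fun u _ => hp (u, v)
  -- Continuity of `t * log t` at zero covers cells of probability zero.
  have hf : ∀ {f : ι → ℝ} {t : ℝ}, Tendsto f l (nhds t) →
      Tendsto (fun n => f n * Real.log (f n)) l (nhds (t * Real.log t)) := fun {f t} h =>
    (Real.continuous_mul_log.tendsto t).comp h
  have hinfo : Tendsto (fun n => empiricalInfo (c n) / (∑ z, c n z : ℕ)) l
      (nhds (∑ z, p z * Real.log (p z) -
        ∑ u, (∑ v, p (u, v)) * Real.log (∑ v, p (u, v)) -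
        ∑ v, (∑ u, p (u, v)) * Real.log (∑ u, p (u, v)))) := by
    refine Tendsto.congr' ?_ (((tendsto_finsetSum _ fun z _ => hf (hp z)).sub
      (tendsto_finsetSum _ fun u _ => hf (hrow u))).sub
      (tendsto_finsetSum _ fun v _ => hf (hcol v)))
    filter_upwards [hN.eventually_gt_atTop 0] with n hn
    rw [empiricalInfo_eq (c n) hn rfl, mul_div_cancel_left₀ _ (by positivity)]
  have hinv : Tendsto (fun n => C / ((∑ z, c n z : ℕ) : ℝ)) l (nhds 0) :=
    (tendsto_const_div_atTop_nhds_zero_nat C).comp hN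
  have hlog : Tendsto (fun n => D * (Real.log (∑ z, c n z : ℕ) / ((∑ z, c n z : ℕ) : ℝ))) l
      (nhds 0) := by
    simpa using (tendsto_log_natCast_div_atTop.comp hN).const_mul D
  have hdiff : Tendsto (fun n => logBayesFactor a a' b (c n) / (∑ z, c n z : ℕ) -
      empiricalInfo (c n) / (∑ z, c n z : ℕ)) l (nhds 0) := by
    have hsum := hinv.add hlog
    rw [zero_add] at hsum
    refine squeeze_zero_norm (fun n => ?_) hsum
    rw [Real.norm_eq_abs, ← sub_div, abs_div, Nat.abs_cast, ← mul_div_assoc, ← add_div]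
    have hnn : (0 : ℝ) ≤ (∑ z, c n z : ℕ) := Nat.cast_nonneg _
    refine div_le_div_of_nonneg_right ?_ hnn
    have h1 := abs_le.mp (hC (c n))
    have h2 := abs_le.mp (hD (c n))
    rw [abs_le]
    constructor <;> linarith [h1.1, h1.2, h2.1, h2.2]
  simpa using hdiff.add hinfo

/-- A quadratic bound for the empirical mutual information in terms of the deviations from a
product distribution. -/
lemma empiricalInfo_le_of_product {c : α × β → ℕ} {q : α → ℝ} {q' : β → ℝ} (hq : ∀ u, 0 ≤ q u)
    (hq' : ∀ v, 0 ≤ q' v) (hq1 : ∑ u, q u = 1) (hq1' : ∑ v, q' v = 1)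
    (hc : ∀ u v, q u * q' v = 0 → c (u, v) = 0) (hN : 0 < ∑ z, c z) :
    empiricalInfo c ≤ ∑ z : α × β,
      ((c z : ℝ) - (∑ z, c z : ℕ) * (q z.1 * q' z.2)) ^ 2 /
        ((∑ z, c z : ℕ) * (q z.1 * q' z.2)) := by
  set N : ℝ := ((∑ z, c z : ℕ) : ℝ) with hNdef
  have hN' : 0 < N := by rw [hNdef]; exact_mod_cast hN
  have hNsum : N = ∑ z, (c z : ℝ) := by rw [hNdef]; push_cast; rfl
  have hr : ∑ u, ((∑ v, c (u, v) : ℕ) : ℝ) = N := by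
    rw [hNdef, Fintype.sum_prod_type]
    push_cast
    rfl
  have hs : ∑ v, ((∑ u, c (u, v) : ℕ) : ℝ) = N := by
    rw [hNdef, Fintype.sum_prod_type_right]
    push_cast
    rfl
  -- The empirical marginals enter with a minus sign, so by Gibbs' inequality replacing them by `N *
  -- q` and `N * q'` only increases the expression.
  have g₁ : ∑ u, ((∑ v, c (u, v) : ℕ) : ℝ) * Real.log (N * q u) ≤
      ∑ u, ((∑ v, c (u, v) : ℕ) : ℝ) * Real.log ((∑ v, c (u, v) : ℕ) : ℝ) := by
    refine sum_mul_log_le (fun u => Nat.cast_nonneg _) (fun u => mul_nonneg hN'.le (hq u))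
      (fun u hu => ?_) ?_
    · have hu : q u = 0 := (mul_eq_zero.mp hu).resolve_left hN'.ne'
      rw [Nat.cast_eq_zero]
      exact Finset.sum_eq_zero fun v _ => hc u v (by simp [hu])
    · rw [← Finset.mul_sum, hq1, mul_one, hr]
  have g₂ : ∑ v, ((∑ u, c (u, v) : ℕ) : ℝ) * Real.log (N * q' v) ≤
      ∑ v, ((∑ u, c (u, v) : ℕ) : ℝ) * Real.log ((∑ u, c (u, v) : ℕ) : ℝ) := by
    refine sum_mul_log_le (fun u => Nat.cast_nonneg _) (fun v => mul_nonneg hN'.le (hq' v))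
      (fun v hv => ?_) ?_
    · have hv : q' v = 0 := (mul_eq_zero.mp hv).resolve_left hN'.ne'
      rw [Nat.cast_eq_zero]
      exact Finset.sum_eq_zero fun u _ => hc u v (by simp [hv])
    · rw [← Finset.mul_sum, hq1', mul_one, hs]
  have e₁ : ∑ u, ((∑ v, c (u, v) : ℕ) : ℝ) * Real.log (N * q u) =
      ∑ z : α × β, (c z : ℝ) * Real.log (N * q z.1) := by
    rw [Fintype.sum_prod_type]
    push_cast
    simp only [Finset.sum_mul]
  have e₂ : ∑ v, ((∑ u, c (u, v) : ℕ) : ℝ) * Real.log (N * q' v) =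
      ∑ z : α × β, (c z : ℝ) * Real.log (N * q' z.2) := by
    rw [Fintype.sum_prod_type_right]
    push_cast
    simp only [Finset.sum_mul]
  have e₃ : N * Real.log N = ∑ z, (c z : ℝ) * Real.log N := by
    rw [← Finset.sum_mul, ← hNsum]
  have hle : empiricalInfo c ≤ ∑ z : α × β, (c z : ℝ) *
      (Real.log (c z) - Real.log (N * q z.1) - Real.log (N * q' z.2) + Real.log N) := by
    simp only [mul_add, mul_sub, Finset.sum_add_distrib, Finset.sum_sub_distrib]
    rw [empiricalInfo, ← hNdef]
    linarith
  -- With `e = N * (q * q')`, the termwise bound is `c * log (c / e) ≤ c * (c / e - 1) = (c - e) ^ 2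
  -- / e + (c - e)`; the linear parts sum to zero.
  have hzero : ∑ z : α × β, ((c z : ℝ) - N * (q z.1 * q' z.2)) = 0 := by
    rw [Finset.sum_sub_distrib, ← Finset.mul_sum, ← hNsum, Fintype.sum_prod_type]
    simp only [← Finset.mul_sum, hq1', mul_one, hq1, sub_self]
  refine hle.trans ?_
  rw [← add_zero (∑ z : α × β, _ / _), ← hzero, ← Finset.sum_add_distrib]
  refine Finset.sum_le_sum fun z _ => ?_
  rcases Nat.eq_zero_or_pos (c z) with h0 | h0
  · by_cases hqz : q z.1 * q' z.2 = 0
    · simp [h0, hqz]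
    · have : N * (q z.1 * q' z.2) ≠ 0 := mul_ne_zero hN'.ne' hqz
      rw [h0, Nat.cast_zero, zero_mul, zero_sub, neg_sq, sq, mul_div_cancel_left₀ _ this]
      simp
  · have hne : q z.1 * q' z.2 ≠ 0 := fun h => h0.ne' (hc z.1 z.2 h)
    have hz₁ : q z.1 ≠ 0 := left_ne_zero_of_mul hne
    have hz₂ : q' z.2 ≠ 0 := right_ne_zero_of_mul hne
    have hpos : 0 < N * (q z.1 * q' z.2) :=
      mul_pos hN' (lt_of_le_of_ne (mul_nonneg (hq _) (hq' _)) hne.symm)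
    have hcz : (0 : ℝ) < c z := by exact_mod_cast h0
    have hl : Real.log (c z) - Real.log (N * q z.1) - Real.log (N * q' z.2) + Real.log N =
        Real.log ((c z : ℝ) / (N * (q z.1 * q' z.2))) := by
      rw [Real.log_div hcz.ne' hpos.ne', Real.log_mul hN'.ne' hz₁, Real.log_mul hN'.ne' hz₂,
        Real.log_mul hN'.ne' hne, Real.log_mul hz₁ hz₂]
      ring
    rw [hl]
    refine (mul_le_mul_of_nonneg_left (Real.log_le_sub_one_of_pos (div_pos hcz hpos))
      hcz.le).trans (le_of_eq ?_)
    field_simp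
    ring

lemma tendsto_div_of_abs_sub_le {f N : ι → ℕ} {t : ℝ} (hN : Tendsto N l atTop)
    (h : ∀ᶠ n in l, |(f n : ℝ) - N n * t| ≤ √(N n * Real.log (N n))) :
    Tendsto (fun n => (f n : ℝ) / N n) l (nhds t) := by
  have hlim : Tendsto (fun n => √(Real.log (N n) / N n)) l (nhds 0) := by
    simpa using (tendsto_log_natCast_div_atTop.comp hN).sqrt
  refine tendsto_iff_norm_sub_tendsto_zero.mpr (squeeze_zero' (.of_forall fun _ => norm_nonneg _)
    ?_ hlim)
  filter_upwards [h, hN.eventually_gt_atTop 0] with n hn hpos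
  have hpos' : (0 : ℝ) < N n := by exact_mod_cast hpos
  have e : (f n : ℝ) / N n - t = ((f n : ℝ) - N n * t) / N n := by
    field_simp
  rw [Real.norm_eq_abs, e, abs_div, Nat.abs_cast, div_le_iff₀ hpos']
  refine hn.trans (le_of_eq ?_)
  rw [Real.sqrt_div' _ hpos'.le, Real.sqrt_mul hpos'.le, div_mul_eq_mul_div,
    eq_div_iff (Real.sqrt_pos.mpr hpos').ne', mul_right_comm, Real.mul_self_sqrt hpos'.le,
    mul_comm]

/-- For `t > 0` the difference of logarithms converges to `log t`. For `t = 0` there is no such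
control and the coefficient must vanish: hence the alternative between positive marginals and
hyperparameters `1/2`. -/
lemma exists_eventually_abs_mul_log_sub_log_le {f N : ι → ℕ} {t d : ℝ}
    (h : Tendsto (fun n => (f n : ℝ) / N n) l (nhds t)) (htd : 0 < t ∨ d = 0) :
    ∃ C, ∀ᶠ n in l, |d * (Real.log (f n) - Real.log (N n))| ≤ C := by
  rcases htd with ht | rfl
  · refine ⟨|d * Real.log t| + 1, ?_⟩
    have hlim := (((h.log ht.ne').const_mul d).abs).eventually_le_const (lt_add_one _)
    filter_upwards [hlim, h.eventually_const_lt ht] with n hn hpos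
    have hf : (f n : ℝ) ≠ 0 := fun h0 => by simp [h0] at hpos
    have hN : (N n : ℝ) ≠ 0 := fun h0 => by simp [h0] at hpos
    rwa [Real.log_div hf hN] at hn
  · exact ⟨0, by simp⟩

/-- Comparing every count with the total makes the hyperparameters cancel in the coefficient of `L`,
which leaves the dimension penalty. -/
lemma logPenalty_eq (a : α → ℝ) (a' : β → ℝ) (b : α × β → ℝ) (c : α × β → ℕ) (L : ℝ)
    (hL : L = Real.log ((∑ z, c z : ℕ) : ℝ)) :
    logPenalty a a' b c =
      -(((Fintype.card α : ℝ) - 1) * ((Fintype.card β : ℝ) - 1) / 2) * L +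
      ∑ z, (b z - 1 / 2) * (Real.log (c z) - L) -
      ∑ u, (a u - 1 / 2) * (Real.log ((∑ v, c (u, v) : ℕ) : ℝ) - L) -
      ∑ v, (a' v - 1 / 2) * (Real.log ((∑ u, c (u, v) : ℕ) : ℝ) - L) := by
  simp only [logPenalty, ← hL, mul_sub, Finset.sum_sub_distrib, ← Finset.sum_mul,
    Finset.sum_const, Finset.card_univ, Fintype.card_prod, nsmul_eq_mul]
  push_cast
  ring

/-- If the empirical distributions of the contingency tables deviate from a product distribution
by `o(√(N log N))`, then the Bayes factor eventually favours independence. -/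
lemma eventually_logBayesFactor_nonpos [Nontrivial α] [Nontrivial β] (ha : ∀ u, 0 < a u)
    (ha' : ∀ v, 0 < a' v) (hb : ∀ z, 0 < b z) {q : α → ℝ} {q' : β → ℝ} (hq : ∀ u, 0 ≤ q u)
    (hq' : ∀ v, 0 ≤ q' v) (hq1 : ∑ u, q u = 1) (hq1' : ∑ v, q' v = 1)
    (hprior : ((∀ u, 0 < q u) ∧ ∀ v, 0 < q' v) ∨
      ((∀ u, a u = 1 / 2) ∧ (∀ v, a' v = 1 / 2) ∧ ∀ z, b z = 1 / 2))
    (hN : Tendsto (fun n => ∑ z, c n z) l atTop)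
    (hc : ∀ n u v, q u * q' v = 0 → c n (u, v) = 0)
    (hdev : ∀ ε > 0, ∀ᶠ n in l, ∀ z : α × β,
      |(c n z : ℝ) - (∑ z, c n z : ℕ) * (q z.1 * q' z.2)| ≤
        ε * √((∑ z, c n z : ℕ) * Real.log (∑ z, c n z : ℕ))) :
    ∀ᶠ n in l, logBayesFactor a a' b (c n) ≤ 0 := by
  obtain ⟨C, hC⟩ := exists_abs_logBayesFactor_le ha ha' hb
  have hp : ∀ z : α × β, Tendsto (fun n => (c n z : ℝ) / (∑ z, c n z : ℕ)) l
      (nhds (q z.1 * q' z.2)) := by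
    intro z
    refine tendsto_div_of_abs_sub_le hN ?_
    filter_upwards [hdev 1 one_pos] with n hn
    simpa using hn z
  have hrow : ∀ u, Tendsto (fun n => ((∑ v, c n (u, v) : ℕ) : ℝ) / (∑ z, c n z : ℕ)) l
      (nhds (q u)) := by
    intro u
    simp only [Nat.cast_sum (R := ℝ) Finset.univ fun v => c _ (u, v), Finset.sum_div]
    have h := tendsto_finsetSum Finset.univ fun v _ => hp (u, v)
    simpa only [← Finset.mul_sum, hq1', mul_one] using h
  have hcol : ∀ v, Tendsto (fun n => ((∑ u, c n (u, v) : ℕ) : ℝ) / (∑ z, c n z : ℕ)) l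
      (nhds (q' v)) := by
    intro v
    simp only [Nat.cast_sum (R := ℝ) Finset.univ fun u => c _ (u, v), Finset.sum_div]
    have h := tendsto_finsetSum Finset.univ fun u _ => hp (u, v)
    simpa only [← Finset.sum_mul, hq1, one_mul] using h
  choose C₁ hC₁ using fun z : α × β => exists_eventually_abs_mul_log_sub_log_le
    (d := b z - 1 / 2) (hp z)
    (hprior.imp (fun h => mul_pos (h.1 _) (h.2 _)) fun h => by rw [h.2.2, sub_self])
  choose C₂ hC₂ using fun u => exists_eventually_abs_mul_log_sub_log_le
    (d := a u - 1 / 2) (hrow u) (hprior.imp (fun h => h.1 _) fun h => by rw [h.1, sub_self])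
  choose C₃ hC₃ using fun v => exists_eventually_abs_mul_log_sub_log_le
    (d := a' v - 1 / 2) (hcol v) (hprior.imp (fun h => h.2 _) fun h => by rw [h.2.1, sub_self])
  -- This `ε` makes the chi-square bound at most `ε ^ 2 * S * L ≤ L / 4`. The dimension penalty is
  -- at least `L / 2`, and the remaining `L / 4` absorbs the bounded terms. Cells of probability
  -- zero contribute `1 / 0 = 0` to `S`.
  set S : ℝ := ∑ z : α × β, 1 / (q z.1 * q' z.2) with hS
  have hS0 : 0 ≤ S := Finset.sum_nonneg fun z _ => one_div_nonneg.mpr (mul_nonneg (hq _) (hq' _))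
  set ε : ℝ := √(1 / (4 * (S + 1))) with hε
  have hε0 : 0 < ε := Real.sqrt_pos.mpr (by positivity)
  have hεS : ε ^ 2 * S ≤ 1 / 4 := by
    rw [hε, Real.sq_sqrt (by positivity), div_mul_eq_mul_div, one_mul,
      div_le_div_iff₀ (by positivity) (by norm_num)]
    linarith
  have hlog : Tendsto (fun n => Real.log (∑ z, c n z : ℕ)) l atTop :=
    Real.tendsto_log_atTop.comp (tendsto_natCast_atTop_atTop.comp hN)
  filter_upwards [hdev ε hε0, eventually_all.mpr hC₁, eventually_all.mpr hC₂,
    eventually_all.mpr hC₃, hN.eventually_gt_atTop 0, hlog.eventually_ge_atTop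
      (4 * (C + ∑ z, C₁ z + ∑ u, C₂ u + ∑ v, C₃ v))] with n hdn h₁ h₂ h₃ hpos hbig
  set L : ℝ := Real.log (∑ z, c n z : ℕ) with hL
  have hL0 : 0 ≤ L := Real.log_natCast_nonneg _
  have hNpos : (0 : ℝ) < (∑ z, c n z : ℕ) := by exact_mod_cast hpos
  have hinfo : empiricalInfo (c n) ≤ 1 / 4 * L := by
    refine (empiricalInfo_le_of_product hq hq' hq1 hq1' (hc n) hpos).trans ?_
    refine le_trans ?_ (mul_le_mul_of_nonneg_right hεS hL0)
    rw [mul_assoc, mul_comm S L, hS, Finset.mul_sum, Finset.mul_sum]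
    refine Finset.sum_le_sum fun z _ => ?_
    rcases (mul_nonneg (hq z.1) (hq' z.2)).eq_or_lt with h0 | h0
    · simp [← h0]
    rw [div_le_iff₀ (mul_pos hNpos h0)]
    have hsq := pow_le_pow_left₀ (abs_nonneg _) (hdn z) 2
    rw [sq_abs, mul_pow, Real.sq_sqrt (mul_nonneg hNpos.le hL0)] at hsq
    refine hsq.trans (le_of_eq ?_)
    generalize q z.1 * q' z.2 = t at h0 ⊢
    field_simp
  have hα : (2 : ℝ) ≤ Fintype.card α := by exact_mod_cast Fintype.one_lt_card (α := α)
  have hβ : (2 : ℝ) ≤ Fintype.card β := by exact_mod_cast Fintype.one_lt_card (α := β)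
  have hdim : 1 / 2 * L ≤ ((Fintype.card α : ℝ) - 1) * ((Fintype.card β : ℝ) - 1) / 2 * L := by
    refine mul_le_mul_of_nonneg_right ?_ hL0
    nlinarith
  have k₁ := abs_le.mp ((Finset.abs_sum_le_sum_abs _ _).trans
    (Finset.sum_le_sum fun z (_ : z ∈ Finset.univ) => h₁ z))
  have k₂ := abs_le.mp ((Finset.abs_sum_le_sum_abs _ _).trans
    (Finset.sum_le_sum fun z (_ : z ∈ Finset.univ) => h₂ z))
  have k₃ := abs_le.mp ((Finset.abs_sum_le_sum_abs _ _).trans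
    (Finset.sum_le_sum fun z (_ : z ∈ Finset.univ) => h₃ z))
  have hpen := logPenalty_eq a a' b (c n) L hL
  have hCn := abs_le.mp (hC (c n))
  linarith [hCn.2, k₁.2, k₂.1, k₃.1]

end Counts

/-! ### A maximal Hoeffding inequality and a weak iterated-logarithm bound. -/

section Maximal

variable {Ω : Type*} [MeasurableSpace Ω] {μ : Measure Ω} {Y : ℕ → Ω → ℝ}

lemma integrable_exp_mul_sum (hindep : iIndepFun Y μ) (hsub : ∀ k, HasSubgaussianMGF (Y k) 1 μ)
    (t : ℝ) (n : ℕ) : Integrable (fun ω => Real.exp (t * ∑ k ∈ Finset.range n, Y k ω)) μ :=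
  (HasSubgaussianMGF.sum_of_iIndepFun hindep fun k _ => hsub k).integrable_exp_mul t

variable [IsProbabilityMeasure μ]

/-- The exponentials of the partial sums of independent centered variables form a
submartingale. -/
lemma submartingale_exp_mul_sum (hmeas : ∀ k, Measurable (Y k)) (hindep : iIndepFun Y μ)
    (hsub : ∀ k, HasSubgaussianMGF (Y k) 1 μ) (hmean : ∀ k, ∫ ω, Y k ω ∂μ = 0) (t : ℝ) :
    Submartingale (fun n ω => Real.exp (t * ∑ k ∈ Finset.range (n + 1), Y k ω))
      (Filtration.natural Y fun k => (hmeas k).stronglyMeasurable) μ := by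
  have hY : ∀ k, StronglyMeasurable (Y k) := fun k => (hmeas k).stronglyMeasurable
  have hadp : ∀ n, StronglyMeasurable[Filtration.natural Y hY n]
      (fun ω => Real.exp (t * ∑ k ∈ Finset.range (n + 1), Y k ω)) := by
    intro n
    refine Real.continuous_exp.comp_stronglyMeasurable
      (StronglyMeasurable.const_mul (Finset.stronglyMeasurable_fun_sum _ fun k hk => ?_) t)
    exact (Filtration.stronglyAdapted_natural hY k).mono
      ((Filtration.natural Y hY).mono (Nat.lt_succ_iff.mp (Finset.mem_range.mp hk)))
  refine submartingale_nat hadp (fun n => integrable_exp_mul_sum hindep hsub t (n + 1)) fun n => ?_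
  set f : Ω → ℝ := fun ω => Real.exp (t * ∑ k ∈ Finset.range (n + 1), Y k ω) with hf
  set g : Ω → ℝ := fun ω => Real.exp (t * Y (n + 1) ω) with hg
  have hgint : Integrable g μ := (hsub (n + 1)).integrable_exp_mul t
  have hfg : (fun ω => Real.exp (t * ∑ k ∈ Finset.range (n + 1 + 1), Y k ω)) = f * g := by
    funext ω
    rw [Pi.mul_apply, hf, hg, ← Real.exp_add, Finset.sum_range_succ _ (n + 1), mul_add]
  have hfgint : Integrable (f * g) μ := hfg ▸ integrable_exp_mul_sum hindep hsub t (n + 2)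
  have h1 := condExp_mul_of_stronglyMeasurable_left (hadp n) hfgint hgint
  -- The time-`n` sum contains `Y 0, …, Y n`, so the new factor `g` is independent of the past; its
  -- mean is at least one by `1 + y ≤ exp y` and centering.
  have h2 : μ[g | Filtration.natural Y hY n] =ᵐ[μ] fun _ => μ[g] := by
    refine condExp_indep_eq (m₁ := MeasurableSpace.comap (Y (n + 1)) inferInstance)
      (hmeas (n + 1)).comap_le (Filtration.le _ _) ?_
      (hindep.indep_comap_natural_of_lt hY (Nat.lt_succ_self n))
    exact Real.continuous_exp.comp_stronglyMeasurable
      (StronglyMeasurable.const_mul (comap_measurable (Y (n + 1))).stronglyMeasurable t)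
  have h3 : 1 ≤ ∫ ω, g ω ∂μ := by
    have hfint := (hsub (n + 1)).integrable
    calc (1 : ℝ) = ∫ ω, (t * Y (n + 1) ω + 1) ∂μ := by
          rw [integral_add (hfint.const_mul t) (integrable_const 1), integral_const_mul, hmean]
          simp
      _ ≤ ∫ ω, g ω ∂μ := integral_mono ((hfint.const_mul t).add (integrable_const 1)) hgint
          fun ω => Real.add_one_le_exp _
  rw [hfg]
  filter_upwards [h1, h2] with ω hω1 hω2
  rw [hω1, Pi.mul_apply, hω2]
  exact le_mul_of_one_le_right (Real.exp_pos _).le h3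

/-- The maximal form of Hoeffding's inequality. -/
lemma measure_exists_le_sum_le (hmeas : ∀ k, Measurable (Y k)) (hindep : iIndepFun Y μ)
    (hsub : ∀ k, HasSubgaussianMGF (Y k) 1 μ) (hmean : ∀ k, ∫ ω, Y k ω ∂μ = 0) {n : ℕ}
    (hn : 0 < n) {x : ℝ} (hx : 0 ≤ x) :
    μ {ω | ∃ k, 0 < k ∧ k ≤ n ∧ x ≤ ∑ i ∈ Finset.range k, Y i ω} ≤
      ENNReal.ofReal (Real.exp (-(x ^ 2 / (2 * n)))) := by
  obtain ⟨n, rfl⟩ : ∃ m, n = m + 1 := ⟨n - 1, by omega⟩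
  -- This `t` minimizes the Chernoff exponent `(n + 1) * t ^ 2 / 2 - t * x`.
  set t : ℝ := x / ((n + 1 : ℕ) : ℝ) with ht
  have hn' : (0 : ℝ) < ((n + 1 : ℕ) : ℝ) := by positivity
  have ht0 : 0 ≤ t := div_nonneg hx hn'.le
  set f : ℕ → Ω → ℝ := fun n ω => Real.exp (t * ∑ k ∈ Finset.range (n + 1), Y k ω) with hf
  have hmax := maximal_ineq (submartingale_exp_mul_sum hmeas hindep hsub hmean t)
    (fun n ω => (Real.exp_pos _).le) (ε := ⟨Real.exp (t * x), (Real.exp_pos _).le⟩) n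
  set U : Set Ω := {ω | Real.exp (t * x) ≤
    (Finset.range (n + 1)).sup' Finset.nonempty_range_add_one fun k => f k ω} with hU
  have hfint := integrable_exp_mul_sum hindep hsub t (n + 1)
  have hmgf : ∫ ω, f n ω ∂μ ≤ Real.exp (((n + 1 : ℕ) : ℝ) * t ^ 2 / 2) := by
    have h := (HasSubgaussianMGF.sum_of_iIndepFun (s := Finset.range (n + 1)) hindep
      fun k _ => hsub k).mgf_le t
    simpa [mgf] using h
  have hset : ∫ ω in U, f n ω ∂μ ≤ Real.exp (((n + 1 : ℕ) : ℝ) * t ^ 2 / 2) :=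
    (setIntegral_le_integral hfint (.of_forall fun ω => (Real.exp_pos _).le)).trans hmgf
  have hsubset : {ω | ∃ k, 0 < k ∧ k ≤ n + 1 ∧ x ≤ ∑ i ∈ Finset.range k, Y i ω} ⊆ U := by
    rintro ω ⟨k, hk0, hkn, hk⟩
    obtain ⟨k, rfl⟩ : ∃ m, k = m + 1 := ⟨k - 1, by omega⟩
    exact (Real.exp_le_exp.mpr (mul_le_mul_of_nonneg_left hk ht0)).trans
      (Finset.le_sup' (fun k => f k ω) (Finset.mem_range.mpr (by omega)))
  refine (measure_mono hsubset).trans ?_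
  have hmain : ENNReal.ofReal (Real.exp (t * x)) * μ U ≤
      ENNReal.ofReal (Real.exp (((n + 1 : ℕ) : ℝ) * t ^ 2 / 2)) := by
    refine le_trans (le_of_eq_of_le ?_ hmax) (ENNReal.ofReal_le_ofReal hset)
    congr 1
    rw [ENNReal.ofReal, Real.toNNReal_of_nonneg (Real.exp_pos _).le]
    rfl
  have hE : (0 : ℝ) < Real.exp (t * x) := Real.exp_pos _
  rw [mul_comm, ← ENNReal.le_div_iff_mul_le (Or.inl (by simpa using hE)) (Or.inl (by simp)),
    ← ENNReal.ofReal_div_of_pos hE, ← Real.exp_sub] at hmain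
  refine hmain.trans (ENNReal.ofReal_le_ofReal (Real.exp_le_exp.mpr (le_of_eq ?_)))
  rw [ht]
  field_simp
  ring

/-- A one-sided weak form of the law of the iterated logarithm. -/
lemma ae_eventually_sum_le (hmeas : ∀ k, Measurable (Y k)) (hindep : iIndepFun Y μ)
    (hsub : ∀ k, HasSubgaussianMGF (Y k) 1 μ) (hmean : ∀ k, ∫ ω, Y k ω ∂μ = 0) {ε : ℝ}
    (hε : 0 < ε) :
    ∀ᵐ ω ∂μ, ∀ᶠ n : ℕ in atTop, ∑ k ∈ Finset.range n, Y k ω ≤ ε * √(n * Real.log n) := by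
  -- The maximum up to `2 ^ (r + 1)` is tested against the threshold at `2 ^ r`. The exponent is `x
  -- r ^ 2 / (2 * 2 ^ (r + 1)) = r * ε ^ 2 * log 2 / 4`, so the bounds form a geometric series.
  set x : ℕ → ℝ := fun r => ε * √((2 ^ r : ℕ) * Real.log (2 ^ r : ℕ)) with hx
  set ρ : ℝ := Real.exp (-(ε ^ 2 * Real.log 2 / 4)) with hρ
  have hρ1 : ρ < 1 := by
    rw [hρ, Real.exp_lt_one_iff]
    have := Real.log_pos one_lt_two
    have : 0 < ε ^ 2 * Real.log 2 / 4 := by positivity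
    linarith
  have hbound : ∀ r, μ {ω | ∃ k, 0 < k ∧ k ≤ 2 ^ (r + 1) ∧ x r ≤ ∑ i ∈ Finset.range k, Y i ω} ≤
      ENNReal.ofReal (ρ ^ r) := by
    intro r
    have hL : 0 ≤ Real.log (2 ^ r : ℕ) := Real.log_natCast_nonneg _
    refine (measure_exists_le_sum_le hmeas hindep hsub hmean (by positivity) (by positivity)).trans
      (ENNReal.ofReal_le_ofReal (le_of_eq ?_))
    rw [hρ, ← Real.exp_nat_mul]
    congr 1
    simp only [hx]
    rw [mul_pow, Real.sq_sqrt (by positivity)]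
    push_cast
    rw [Real.log_pow, pow_succ]
    field_simp
    ring
  have hsum : ∑' r, μ {ω | ∃ k, 0 < k ∧ k ≤ 2 ^ (r + 1) ∧
      x r ≤ ∑ i ∈ Finset.range k, Y i ω} ≠ ⊤ := by
    refine ne_top_of_le_ne_top ?_ (ENNReal.tsum_le_tsum hbound)
    rw [← ENNReal.ofReal_tsum_of_nonneg (fun r => by positivity)
      (summable_geometric_of_lt_one (Real.exp_pos _).le hρ1)]
    exact ENNReal.ofReal_ne_top
  filter_upwards [ae_eventually_notMem hsum] with ω hω
  obtain ⟨R, hR⟩ := eventually_atTop.mp hω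
  filter_upwards [eventually_ge_atTop (2 ^ R)] with n hn
  have hn0 : n ≠ 0 := by
    have : 0 < 2 ^ R := by positivity
    omega
  have hr : R ≤ Nat.log 2 n := Nat.le_log_of_pow_le one_lt_two hn
  have h1 : 2 ^ Nat.log 2 n ≤ n := Nat.pow_log_le_self 2 hn0
  have h2 : n < 2 ^ (Nat.log 2 n + 1) := Nat.lt_pow_succ_log_self one_lt_two n
  have hlt : ∑ k ∈ Finset.range n, Y k ω < x (Nat.log 2 n) := by
    by_contra! hcon
    exact hR _ hr ⟨n, Nat.pos_of_ne_zero hn0, h2.le, hcon⟩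
  refine hlt.le.trans (mul_le_mul_of_nonneg_left (Real.sqrt_le_sqrt ?_) hε.le)
  exact mul_le_mul (by exact_mod_cast h1) (log_natCast_le_log_natCast h1)
    (Real.log_natCast_nonneg _) (Nat.cast_nonneg _)

/-- A weak form of the law of the iterated logarithm. -/
lemma ae_eventually_abs_sum_le (hmeas : ∀ k, Measurable (Y k)) (hindep : iIndepFun Y μ)
    (hsub : ∀ k, HasSubgaussianMGF (Y k) 1 μ) (hmean : ∀ k, ∫ ω, Y k ω ∂μ = 0) {ε : ℝ}
    (hε : 0 < ε) :
    ∀ᵐ ω ∂μ, ∀ᶠ n : ℕ in atTop, |∑ k ∈ Finset.range n, Y k ω| ≤ ε * √(n * Real.log n) := by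
  have hneg := ae_eventually_sum_le (Y := fun k ω => -Y k ω) (fun k => (hmeas k).neg)
    (hindep.comp (fun _ y => -y) fun _ => measurable_neg) (fun k => (hsub k).neg)
    (fun k => by rw [integral_neg, hmean, neg_zero]) hε
  filter_upwards [ae_eventually_sum_le hmeas hindep hsub hmean hε, hneg] with ω h1 h2
  filter_upwards [h1, h2] with n hn1 hn2
  rw [Finset.sum_neg_distrib] at hn2
  exact abs_le.mpr ⟨by linarith, hn1⟩

end Maximal

/-! ### Deviations of counts along observed rows. -/

section Sampling

variable {Ω : Type*} [MeasurableSpace Ω] {μ : Measure Ω} [IsProbabilityMeasure μ]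
  {S : Type*} [MeasurableSpace S] {X : ℕ → Ω → S}

/-- Enumerating the selected rows by `Nat.nth` turns a sum over observed rows into an ordinary
partial sum of a subsequence. -/
lemma sum_filter_range_eq_sum_nth {s : ℕ → Prop} [DecidablePred s] (f : ℕ → ℝ) (n : ℕ) :
    ∑ k ∈ Finset.range n with s k, f k =
      ∑ j ∈ Finset.range ((Finset.range n).filter s).card, f (Nat.nth s j) := by
  rw [← Nat.count_eq_card_filter_range]
  induction n with
  | zero => simp
  | succ n ih =>
    rw [Finset.range_add_one, Finset.filter_insert, Nat.count_succ]
    by_cases hn : s n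
    · rw [if_pos hn, if_pos hn, Finset.sum_insert (by simp), Finset.sum_range_succ, ih,
        Nat.nth_count hn, add_comm]
    · rw [if_neg hn, if_neg hn, ih, add_zero]

/-- Among the samples in a fixed set of rows, the number of occurrences of an event deviates from
its mean by `o(√(N log N))`, where `N` is the number of rows. -/
lemma ae_exists_forall_abs_card_sub_le {P : Measure S} (hX : ∀ k, Measurable (X k))
    (hlaw : ∀ k, μ.map (X k) = P) (hindep : iIndepFun X μ) {B : S → Prop} [DecidablePred B]
    (hB : MeasurableSet {y | B y}) {ε : ℝ} (hε : 0 < ε) (s : ℕ → Prop) [DecidablePred s] :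
    ∀ᵐ ω ∂μ, ∃ N₀ : ℕ, ∀ n, N₀ ≤ ((Finset.range n).filter s).card →
      |((((Finset.range n).filter s).filter fun k => B (X k ω)).card : ℝ) -
        ((Finset.range n).filter s).card * P.real {y | B y}| ≤
        ε * √(((Finset.range n).filter s).card *
          Real.log ((Finset.range n).filter s).card) := by
  -- If `s` selects finitely many rows, a threshold `N₀` above their number makes the claim vacuous;
  -- otherwise `Nat.nth s` is injective and the subsequence is independent.
  by_cases hs : {k | s k}.Finite
  · refine .of_forall fun ω => ⟨hs.toFinset.card + 1, fun n hn => ?_⟩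
    have : ((Finset.range n).filter s).card ≤ hs.toFinset.card :=
      Finset.card_le_card fun k hk => by simpa using (Finset.mem_filter.mp hk).2
    omega
  have hP : IsProbabilityMeasure P := hlaw 0 ▸ Measure.isProbabilityMeasure_map (hX 0).aemeasurable
  set p : ℝ := P.real {y | B y} with hp
  set φ : S → ℝ := fun y => (if B y then 1 else 0) - p with hφ
  have hφm : Measurable φ := (Measurable.ite hB measurable_const measurable_const).sub_const p
  have hp0 : 0 ≤ p := measureReal_nonneg
  have hp1 : p ≤ 1 := measureReal_le_one
  have hmean : ∀ k, ∫ ω, φ (X k ω) ∂μ = 0 := by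
    intro k
    rw [← integral_map (hX k).aemeasurable hφm.aestronglyMeasurable, hlaw k]
    have hi : (fun y => if B y then (1 : ℝ) else 0) = {y | B y}.indicator fun _ => 1 := by
      funext y
      simp [Set.indicator]
    have hfint : Integrable (fun y => if B y then (1 : ℝ) else 0) P :=
      hi ▸ (integrable_const 1).indicator hB
    rw [hφ, integral_sub hfint (integrable_const p), hi, integral_indicator_const _ hB]
    simp [hp]
  have hsub : ∀ k, HasSubgaussianMGF (fun ω => φ (X k ω)) 1 μ := by
    intro k
    have h := hasSubgaussianMGF_of_mem_Icc_of_integral_eq_zero (a := -1) (b := 1)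
      (hφm.comp (hX k)).aemeasurable (.of_forall fun ω => ?_) (hmean k)
    · have h2 : ‖(1 : ℝ) - -1‖₊ = 2 := NNReal.eq (by norm_num)
      rw [h2, div_self two_ne_zero, one_pow] at h
      exact h
    · simp only [hφ, Function.comp]
      split_ifs <;> constructor <;> linarith
  have hinj : Function.Injective (Nat.nth s) := Nat.nth_injective hs
  have hmain := ae_eventually_abs_sum_le (Y := fun j ω => φ (X (Nat.nth s j) ω))
    (fun j => hφm.comp (hX _))
    ((hindep.precomp hinj).comp (fun _ => φ) fun _ => hφm) (fun j => hsub _) (fun j => hmean _) hε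
  filter_upwards [hmain] with ω hω
  obtain ⟨N₀, hN₀⟩ := eventually_atTop.mp hω
  refine ⟨N₀, fun n hn => ?_⟩
  have h := hN₀ _ hn
  rw [← sum_filter_range_eq_sum_nth fun k => φ (X k ω)] at h
  convert h using 2
  simp only [hφ]
  rw [Finset.sum_sub_distrib, Finset.sum_boole, Finset.sum_const, nsmul_eq_mul]

variable {F : Type*} [MeasurableSpace F] {M : ℕ → Ω → F}

/-- The same for a random set of rows that is independent of the samples. -/
lemma ae_exists_forall_abs_card_sub_le_of_indepFun {P : Measure S} (hX : ∀ k, Measurable (X k))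
    (hlaw : ∀ k, μ.map (X k) = P) (hindep : iIndepFun X μ) (hM : ∀ k, Measurable (M k))
    (hXM : IndepFun (fun ω k => X k ω) (fun ω k => M k ω) μ)
    {B : S → Prop} [DecidablePred B] (hB : MeasurableSet {y | B y})
    {D : F → Prop} [DecidablePred D] (hD : MeasurableSet {y | D y}) {ε : ℝ} (hε : 0 < ε) :
    ∀ᵐ ω ∂μ, ∃ N₀ : ℕ, ∀ n, N₀ ≤ ((Finset.range n).filter fun k => D (M k ω)).card →
      |((((Finset.range n).filter fun k => D (M k ω)).filter fun k => B (X k ω)).card : ℝ) -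
        ((Finset.range n).filter fun k => D (M k ω)).card * P.real {y | B y}| ≤
        ε * √(((Finset.range n).filter fun k => D (M k ω)).card *
          Real.log ((Finset.range n).filter fun k => D (M k ω)).card) := by
  set R : ℕ → ℕ × ℕ → Prop := fun N₀ z => N₀ ≤ z.1 →
    |(z.2 : ℝ) - z.1 * P.real {y | B y}| ≤ ε * √(z.1 * Real.log z.1) with hR
  set T : ℕ → (ℕ → F) × (ℕ → S) → ℕ × ℕ := fun n z =>
    (((Finset.range n).filter fun k => D (z.1 k)).card,
      (((Finset.range n).filter fun k => D (z.1 k)).filter fun k => B (z.2 k)).card) with hT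
  have hTm : ∀ n, Measurable (T n) := by
    intro n
    refine Measurable.prodMk ?_ ?_
    · simp only [Finset.card_filter]
      refine Finset.measurable_fun_sum _ fun k _ => Measurable.ite ?_ measurable_const
        measurable_const
      exact ((measurable_pi_apply k).comp measurable_fst) hD
    · simp only [Finset.filter_filter, Finset.card_filter]
      refine Finset.measurable_fun_sum _ fun k _ => Measurable.ite ?_ measurable_const
        measurable_const
      exact (((measurable_pi_apply k).comp measurable_fst) hD).inter
        (((measurable_pi_apply k).comp measurable_snd) hB)
  have hmeas : MeasurableSet {z | ∃ N₀, ∀ n, R N₀ (T n z)} := by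
    have : {z | ∃ N₀, ∀ n, R N₀ (T n z)} = ⋃ N₀, ⋂ n, T n ⁻¹' {w | R N₀ w} := by
      ext z
      simp
    rw [this]
    exact MeasurableSet.iUnion fun N₀ => MeasurableSet.iInter fun n =>
      hTm n (MeasurableSet.of_discrete)
  have hXm : Measurable fun ω k => X k ω := measurable_pi_lambda _ hX
  have hMm : Measurable fun ω k => M k ω := measurable_pi_lambda _ hM
  have hprod := hXM.symm.map_prod_eq_prod_map_map hMm.aemeasurable hXm.aemeasurable
  have hMp : IsProbabilityMeasure (μ.map fun ω k => M k ω) :=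
    Measure.isProbabilityMeasure_map hMm.aemeasurable
  have hXp : IsProbabilityMeasure (μ.map fun ω k => X k ω) :=
    Measure.isProbabilityMeasure_map hXm.aemeasurable
  have hae : ∀ᵐ z ∂(μ.map fun ω => ((fun k => M k ω), fun k => X k ω)),
      ∃ N₀, ∀ n, R N₀ (T n z) := by
    -- Independence makes the joint law a product, so by Fubini the mask may be fixed.
    rw [hprod, Measure.ae_prod_iff_ae_ae hmeas]
    refine .of_forall fun m => ?_
    have hm : MeasurableSet {x | ∃ N₀, ∀ n, R N₀ (T n (m, x))} := measurable_prodMk_left hmeas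
    rw [ae_map_iff hXm.aemeasurable hm]
    exact ae_exists_forall_abs_card_sub_le hX hlaw hindep hB hε fun k => D (m k)
  rw [ae_map_iff (hMm.prodMk hXm).aemeasurable hmeas] at hae
  exact hae

end Sampling

/-! ### The weights as normalized log Bayes factors. -/

section Weights

variable {V : Type*} {A : V → Type*} [∀ i, Fintype (A i)] [∀ i, DecidableEq (A i)]

/-- The contingency table of the rows in which `i` and `j` are both observed. -/
def jointCount (x : ℕ → ∀ i, A i) (m : ℕ → V → Bool) (n : ℕ) (i j : V) (z : A i × A j) : ℕ :=
  ((jointRows m n i j).filter fun k => x k i = z.1 ∧ x k j = z.2).card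

variable (x : ℕ → ∀ i, A i) (m : ℕ → V → Bool) (n : ℕ) (i j : V)

lemma sum_jointCount_right (u : A i) :
    ∑ v, jointCount x m n i j (u, v) =
      ((jointRows m n i j).filter fun k => x k i = u).card := by
  rw [Finset.card_eq_sum_card_fiberwise (f := fun k => x k j) (t := Finset.univ) (by simp)]
  simp only [Finset.filter_filter, jointCount]

lemma sum_jointCount_left (v : A j) :
    ∑ u, jointCount x m n i j (u, v) =
      ((jointRows m n i j).filter fun k => x k j = v).card := by
  rw [Finset.card_eq_sum_card_fiberwise (f := fun k => x k i) (t := Finset.univ) (by simp)]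
  simp only [Finset.filter_filter, jointCount, and_comm]

lemma sum_jointCount : ∑ z, jointCount x m n i j z = (jointRows m n i j).card := by
  rw [Fintype.sum_prod_type, Finset.card_eq_sum_card_fiberwise (f := fun k => x k i)
    (t := Finset.univ) (by simp)]
  exact Finset.sum_congr rfl fun u _ => sum_jointCount_right x m n i j u

lemma weightK_eq (a : ∀ i, A i → ℝ) (b : ∀ i j, A i → A j → ℝ) :
    weightK a b x m n i j = logBayesFactor (a i) (a j) (fun z => b i j z.1 z.2)
      (jointCount x m n i j) / (∑ z, jointCount x m n i j z : ℕ) := by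
  have hrows : jointRows m n j i = jointRows m n i j := by
    simp only [jointRows, and_comm]
  rw [sum_jointCount, weightK, one_div, inv_mul_eq_div, logBayesFactor]
  simp only [sum_jointCount_right, sum_jointCount_left, bayesPair, bayesSingle, hrows]
  rfl

end Weights

/-! ### Almost sure behaviour of the weights. -/

section Consistency

variable {V : Type*} [Fintype V] {A : V → Type*} [∀ i, Fintype (A i)]
  [∀ i, MeasurableSpace (A i)] [∀ i, MeasurableSingletonClass (A i)]

variable {Ω : Type*} [MeasurableSpace Ω] {μ : Measure Ω}
  {P : Measure (∀ i, A i)} {X : ℕ → Ω → ∀ i, A i}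

/-- Almost surely, only configurations of positive probability occur. -/
lemma ae_forall_real_singleton_pos [DecidableEq V] [IsProbabilityMeasure P] (hX : ∀ k, Measurable (X k))
    (hX_law : ∀ k, μ.map (X k) = P) : ∀ᵐ ω ∂μ, ∀ k, 0 < P.real {X k ω} := by
  refine ae_all_iff.mpr fun k => ?_
  have h : ∀ᵐ y ∂P, 0 < P.real {y} := by
    have h0 : P {y | ¬ 0 < P.real {y}} = 0 := by
      rw [← measureReal_eq_zero_iff, real_eq_sum_filter]
      exact Finset.sum_eq_zero fun y hy =>
        le_antisymm (not_lt.mp (Finset.mem_filter.mp hy).2) measureReal_nonneg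
    exact h0
  rw [← hX_law k] at h
  have h' := ae_of_ae_map (hX k).aemeasurable h
  rwa [hX_law k] at h'

variable [∀ i, DecidableEq (A i)]

lemma mutualInfo_eq_sub_entropy [DecidableEq V] (P : Measure (∀ i, A i))
    [IsProbabilityMeasure P] (i j : V) :
    mutualInfo P i j =
      ∑ z : A i × A j, pairMarginal P i j z.1 z.2 * Real.log (pairMarginal P i j z.1 z.2) -
        ∑ u, (∑ v, pairMarginal P i j u v) * Real.log (∑ v, pairMarginal P i j u v) -
        ∑ v, (∑ u, pairMarginal P i j u v) * Real.log (∑ u, pairMarginal P i j u v) := by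
  have h : ∀ u v, pairMarginal P i j u v * Real.log (marginal P i u * marginal P j v) =
      pairMarginal P i j u v * Real.log (marginal P i u) +
        pairMarginal P i j u v * Real.log (marginal P j v) := by
    intro u v
    rcases (pairMarginal_nonneg P i j u v).eq_or_lt with h | h
    · simp [← h]
    · rw [Real.log_mul (h.trans_le (pairMarginal_le_left P i j u v)).ne'
        (h.trans_le (pairMarginal_le_right P i j u v)).ne', mul_add]
  rw [mutualInfo_eq_sub, sub_sub]
  congr 1
  simp only [h, Finset.sum_add_distrib]
  congr 1
  · rw [Fintype.sum_prod_type]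
    simp only [← Finset.sum_mul, sum_pairMarginal_right]
  · rw [Fintype.sum_prod_type_right]
    simp only [← Finset.sum_mul, sum_pairMarginal_left]

variable [IsProbabilityMeasure μ] {M : ℕ → Ω → V → Bool}

/-- Almost surely, the joint counts deviate from their means by `o(√(N log N))`. -/
lemma ae_forall_eventually_abs_jointCount_sub_le (hX : ∀ k, Measurable (X k))
    (hX_law : ∀ k, μ.map (X k) = P) (hX_indep : iIndepFun X μ) (hM : ∀ k, Measurable (M k))
    (hXM : IndepFun (fun ω k => X k ω) (fun ω k => M k ω) μ) {i j : V}
    (hn : ∀ᵐ ω ∂μ, Tendsto (fun n => (jointRows (fun k => M k ω) n i j).card) atTop atTop) :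
    ∀ᵐ ω ∂μ, ∀ ε > 0, ∀ᶠ n in atTop, ∀ z : A i × A j,
      |(jointCount (fun k => X k ω) (fun k => M k ω) n i j z : ℝ) -
        (∑ z, jointCount (fun k => X k ω) (fun k => M k ω) n i j z : ℕ) *
          pairMarginal P i j z.1 z.2| ≤
        ε * √((∑ z, jointCount (fun k => X k ω) (fun k => M k ω) n i j z : ℕ) *
          Real.log (∑ z, jointCount (fun k => X k ω) (fun k => M k ω) n i j z : ℕ)) := by
  -- Restricting to `ε = 1 / (q + 1)` leaves countably many null sets.
  have hdev : ∀ᵐ ω ∂μ, ∀ (q : ℕ) (z : A i × A j), ∃ N₀ : ℕ, ∀ n,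
      N₀ ≤ (jointRows (fun k => M k ω) n i j).card →
      |(jointCount (fun k => X k ω) (fun k => M k ω) n i j z : ℝ) -
        (jointRows (fun k => M k ω) n i j).card * pairMarginal P i j z.1 z.2| ≤
        1 / ((q : ℝ) + 1) * √((jointRows (fun k => M k ω) n i j).card *
          Real.log (jointRows (fun k => M k ω) n i j).card) := by
    refine ae_all_iff.mpr fun q => ae_all_iff.mpr fun z => ?_
    exact ae_exists_forall_abs_card_sub_le_of_indepFun hX hX_law hX_indep hM hXM
      (B := fun y => y i = z.1 ∧ y j = z.2) (D := fun m => m i = true ∧ m j = true)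
      (Set.toFinite _).measurableSet (Set.toFinite _).measurableSet (by positivity)
  filter_upwards [hdev, hn] with ω hω hN ε hε
  obtain ⟨q, hq⟩ := exists_nat_one_div_lt hε
  refine eventually_all.mpr fun z => ?_
  obtain ⟨N₀, hN₀⟩ := hω q z
  filter_upwards [hN.eventually_ge_atTop N₀] with n hn
  rw [sum_jointCount]
  exact (hN₀ n hn).trans (mul_le_mul_of_nonneg_right hq.le (Real.sqrt_nonneg _))

/-- Strong consistency of the weights: they converge to the mutual informations, and they are
eventually nonpositive for independent variables. -/
lemma ae_tendsto_weightK [DecidableEq V] [IsProbabilityMeasure P] [∀ i, Nontrivial (A i)]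
    {a : ∀ i, A i → ℝ} (ha : ∀ i u, 0 < a i u) {b : ∀ i j, A i → A j → ℝ} (hb : ∀ i j u v, 0 < b i j u v)
    (hX : ∀ k, Measurable (X k)) (hX_law : ∀ k, μ.map (X k) = P) (hX_indep : iIndepFun X μ)
    (hM : ∀ k, Measurable (M k)) (hXM : IndepFun (fun ω k => X k ω) (fun ω k => M k ω) μ)
    (hprior : (∀ i u, 0 < marginal P i u) ∨
      ((∀ i u, a i u = 1 / 2) ∧ ∀ i j u v, b i j u v = 1 / 2)) {i j : V}
    (hn : ∀ᵐ ω ∂μ, Tendsto (fun n => (jointRows (fun k => M k ω) n i j).card) atTop atTop) :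
    ∀ᵐ ω ∂μ,
      Tendsto (fun n => weightK a b (fun k => X k ω) (fun k => M k ω) n i j) atTop
        (nhds (mutualInfo P i j)) ∧
      (mutualInfo P i j = 0 →
        ∀ᶠ n in atTop, weightK a b (fun k => X k ω) (fun k => M k ω) n i j ≤ 0) := by
  filter_upwards [ae_forall_eventually_abs_jointCount_sub_le hX hX_law hX_indep hM hXM hn, hn,
    ae_forall_real_singleton_pos hX hX_law] with ω hdev hN hpos
  have hN' : Tendsto (fun n => ∑ z, jointCount (fun k => X k ω) (fun k => M k ω) n i j z)
      atTop atTop := by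
    simpa only [sum_jointCount] using hN
  constructor
  · simp only [weightK_eq]
    rw [mutualInfo_eq_sub_entropy]
    refine tendsto_logBayesFactor_div (p := fun z => pairMarginal P i j z.1 z.2) (ha i) (ha j)
      (fun z => hb i j _ _) hN' fun z => tendsto_div_of_abs_sub_le hN' ?_
    filter_upwards [hdev 1 one_pos] with n hn
    simpa only [one_mul] using hn z
  · intro hI
    have hprod := pairMarginal_eq_mul_of_mutualInfo_eq_zero P hI
    simp only [hprod] at hdev
    -- Cells of probability zero stay empty, as the chi-square bound requires where its denominator
    -- vanishes.
    have hc : ∀ n u v, marginal P i u * marginal P j v = 0 →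
        jointCount (fun k => X k ω) (fun k => M k ω) n i j (u, v) = 0 := by
      intro n u v h0
      rw [jointCount, Finset.card_eq_zero, Finset.filter_eq_empty_iff]
      rintro k - ⟨rfl, rfl⟩
      exact ((hpos k).trans_le (real_singleton_le_pairMarginal P (X k ω) i j)).ne'
        ((hprod _ _).trans h0)
    have h := eventually_logBayesFactor_nonpos (ha i) (ha j) (fun z => hb i j z.1 z.2)
      (marginal_nonneg P i) (marginal_nonneg P j) (sum_marginal P i) (sum_marginal P j)
      (hprior.imp (fun h => ⟨h i, h j⟩) fun h => ⟨h.1 i, h.1 j, fun z => h.2 i j z.1 z.2⟩)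
      hN' hc hdev
    filter_upwards [h] with n hn
    rw [weightK_eq]
    exact div_nonpos_of_nonpos_of_nonneg hn (Nat.cast_nonneg _)

end Consistency

end ForestLearning

theorem proposition5 {V : Type*} [Fintype V] [DecidableEq V]
    {A : V → Type*} [∀ i, Fintype (A i)] [∀ i, DecidableEq (A i)] [∀ i, Nontrivial (A i)]
    [∀ i, MeasurableSpace (A i)] [∀ i, MeasurableSingletonClass (A i)]
    (a : ∀ i, A i → ℝ) (ha : ∀ i u, 0 < a i u)
    (b : ∀ i j, A i → A j → ℝ) (hb : ∀ i j u v, 0 < b i j u v)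
    (hb_symm : ∀ i j u v, b i j u v = b j i v u)
    {Ω : Type*} [MeasurableSpace Ω] (μ : Measure Ω) [IsProbabilityMeasure μ]
    (P : Measure (∀ i, A i))
    (X : ℕ → Ω → ∀ i, A i) (hX : ∀ k, Measurable (X k))
    (hX_law : ∀ k, μ.map (X k) = P) (hX_indep : iIndepFun X μ)
    (M : ℕ → Ω → V → Bool) (hM : ∀ k, Measurable (M k))
    (hXM : IndepFun (fun ω k => X k ω) (fun ω k => M k ω) μ)
    (hprior : (∀ i u, 0 < ForestLearning.marginal P i u) ∨
      ((∀ i u, a i u = 1 / 2) ∧ ∀ i j u v, b i j u v = 1 / 2))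
    (hn : ∀ i j, i ≠ j → ∀ᵐ ω ∂μ,
      Tendsto (fun n => (ForestLearning.jointRows (fun k => M k ω) n i j).card) atTop atTop) :
    ∀ᵐ ω ∂μ, ∀ᶠ n in atTop,
      (∃ E, ForestLearning.IsChowLiuOutput
        (ForestLearning.weightK a b (fun k => X k ω) (fun k => M k ω) n) E) ∧
      ∀ E, ForestLearning.IsChowLiuOutput
          (ForestLearning.weightK a b (fun k => X k ω) (fun k => M k ω) n) E →
        ForestLearning.IsChowLiuOutput (ForestLearning.mutualInfo P) E ∧
        ((∃ T, ForestLearning.FactorsAlongForest P T) → ForestLearning.IsTrueForest P E) ∧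
        ∀ T, (∀ T', ForestLearning.IsTrueForest P T' ↔ T' = T) → E = T := by
  have hP : IsProbabilityMeasure P :=
    hX_law 0 ▸ Measure.isProbabilityMeasure_map (hX 0).aemeasurable
  have hcons := ae_all_iff.mpr fun i : V => ae_all_iff.mpr fun j : V => ae_all_iff.mpr
    fun hij : i ≠ j => ForestLearning.ae_tendsto_weightK ha hb hX hX_law hX_indep hM hXM hprior
      (hn i j hij)
  filter_upwards [hcons] with ω hω
  have hlt : ∀ᶠ n in atTop, ∀ i j k l, i ≠ j → k ≠ l →
      ForestLearning.mutualInfo P i j < ForestLearning.mutualInfo P k l →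
      ForestLearning.weightK a b (fun k => X k ω) (fun k => M k ω) n i j <
        ForestLearning.weightK a b (fun k => X k ω) (fun k => M k ω) n k l := by
    simp only [eventually_all]
    exact fun i j k l hij hkl h => (hω i j hij).1.eventually_lt (hω k l hkl).1 h
  have hpos : ∀ᶠ n in atTop, ∀ i j, i ≠ j →
      (0 < ForestLearning.weightK a b (fun k => X k ω) (fun k => M k ω) n i j ↔
        0 < ForestLearning.mutualInfo P i j) := by
    simp only [eventually_all]
    intro i j hij
    rcases (ForestLearning.mutualInfo_nonneg P i j).eq_or_lt with h | h
    · filter_upwards [(hω i j hij).2 h.symm] with n hn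
      simp [← h, hn]
    · filter_upwards [(hω i j hij).1.eventually_const_lt h] with n hn
      simp [h, hn]
  filter_upwards [hlt, hpos] with n hlt hpos
  refine ⟨ForestLearning.exists_isChowLiuOutput _, fun E hE => ?_⟩
  have hE' : ForestLearning.IsChowLiuOutput (ForestLearning.mutualInfo P) E :=
    ForestLearning.ChowLiuState.of_lt_imp_lt hlt hpos hE
  have htrue : (∃ T, ForestLearning.FactorsAlongForest P T) → ForestLearning.IsTrueForest P E :=
    fun ⟨_, hT⟩ => ForestLearning.isTrueForest_of_isChowLiuOutput P hT hE'
  -- The unique true forest `T` itself witnesses that `P` factors along a forest.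
  exact ⟨hE', htrue, fun T hT => (hT E).mp (htrue ⟨T, ((hT T).mpr rfl).prop⟩)⟩
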